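/- Let $p\ge 2$ be an integer. Let $\mathbf F=H^1_0(0,\pi)$ be the space of real functions $f\in L^2(0,\pi)$ whose distributional derivative $f_x$ is in $L^2(0,\pi)$ and whose continuous representative on $[0,\pi]$ satisfies $f(0)=f(\pi)=0$, with inner product $\langle f|g\rangle=\langle f|g\rangle_{L^2}+\langle f_x|g_x\rangle_{L^2}$. Put $s_k(x)=\sqrt{2/\pi}\,\sin(kx)$ and $$\mathcal U(t)f=\sum_{k=1}^{\infty}e^{-k^2t}\,\langle s_k|f\rangle_{L^2}\,s_k\qquad(t\ge 0,\ f\in\mathbf F),$$ the series converging in $\mathbf F$. For $f_0\in\mathbf F$, consider the Volterra problem (the integral form of the nonlinear heat problem $\dot\varphi=\varphi_{xx}+\varphi^p$, $\varphi(0)=f_0$ with Dirichlet boundary conditions) $$\varphi(t)=\mathcal U(t)f_0+\int_0^t\mathcal U(t-s)\,\varphi(s)^p\,ds .\tag{V}$$ A solution is a continuous function $\varphi:J\to\mathbf F$ that satisfies (V) for all $t\in J$, where $J=[0,T)$ with $0<T\le+\infty$ or $J=[0,T]$ with $0<T<+\infty$; it is maximal if it has no proper extension that is a solution. Assume $f_0\ge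 0$ and $$Q(f_0):=\frac12\int_0^\pi \sin x\,f_0(x)\,dx>1,\qquad\text{and put}\qquad t_K:=-\frac1{p-1}\log\Big(1-\frac1{Q(f_0)^{p-1}}\Big)\in(0,+\infty).$$ Then the maximal solution $\varphi:[0,\vartheta)\to\mathbf F$ of (V) has $\vartheta\le t_K$. Likewise, the supremum of the $T\in(0,+\infty]$ for which (V) has a solution on $[0,T)$ is at most $t_K$. -/

import Mathlib

open MeasureTheory Set
open scoped ContDiff

noncomputable section

namespace NLHeat

/-- Lebesgue measure on the interval `(0, π)`. -/
abbrev leb : Measure ℝ := volume.restrict (Ioo 0 Real.pi)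

/-- The real Hilbert space `L²(0, π)`. -/
abbrev L2 : Type := Lp ℝ 2 leb

/-- `g` is the distributional derivative of `f` on `(0, π)`. -/
def HasWeakDeriv (f g : L2) : Prop :=
  ∀ θ : ℝ → ℝ, ContDiff ℝ ∞ θ → HasCompactSupport θ → tsupport θ ⊆ Ioo 0 Real.pi →
    ∫ x in Ioo 0 Real.pi, f x * deriv θ x = -∫ x in Ioo 0 Real.pi, g x * θ x

/-- The class `f` has a representative that is continuous on `[0, π]` and vanishes at `0` and
at `π`. -/
def HasZeroTrace (f : L2) : Prop :=
  ∃ u : ℝ → ℝ, ContinuousOn u (Icc 0 Real.pi) ∧ u 0 = 0 ∧ u Real.pi = 0 ∧ f =ᵐ[leb] u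

/-! Auxiliary facts on the interval. -/

lemma memLp_of_continuousOn {u : ℝ → ℝ} (hu : ContinuousOn u (Icc 0 Real.pi)) :
    MemLp u 2 leb := by
  obtain ⟨C, hC⟩ := isCompact_Icc.exists_bound_of_continuousOn hu
  refine MemLp.of_bound ((hu.mono Ioo_subset_Icc_self).aestronglyMeasurable measurableSet_Ioo) C ?_
  filter_upwards [ae_restrict_mem measurableSet_Ioo] with x hx
  exact hC x (Ioo_subset_Icc_self hx)

lemma intervalIntegrable_L2 (g : L2) : IntervalIntegrable g volume 0 Real.pi := by
  rw [intervalIntegrable_iff_integrableOn_Ioo_of_le Real.pi_pos.le]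
  exact (Lp.memLp g).integrable (by norm_num)

lemma setIntegral_eq (f : ℝ → ℝ) :
    ∫ x in Ioo 0 Real.pi, f x = ∫ x in (0)..Real.pi, f x := by
  rw [intervalIntegral.integral_of_le Real.pi_pos.le, integral_Ioc_eq_integral_Ioo]

/-- The primitive of `g` vanishing at `0`. -/
def primitive (g : L2) (x : ℝ) : ℝ := ∫ t in (0)..x, g t

lemma primitive_ac (g : L2) : AbsolutelyContinuousOnInterval (primitive g) 0 Real.pi :=
  (intervalIntegrable_L2 g).absolutelyContinuousOnInterval_intervalIntegral (by simp)

lemma primitive_continuousOn (g : L2) : ContinuousOn (primitive g) (Icc 0 Real.pi) := by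
  have := (primitive_ac g).continuousOn
  rwa [uIcc_of_le Real.pi_pos.le] at this

lemma primitive_zero (g : L2) : primitive g 0 = 0 := by simp [primitive]

lemma primitive_deriv (g : L2) : deriv (primitive g) =ᵐ[leb] g := by
  have h := (intervalIntegrable_L2 g).ae_hasDerivAt_integral
  rw [Filter.EventuallyEq, ae_restrict_iff' measurableSet_Ioo]
  filter_upwards [h] with x hx hx'
  have hx'' : x ∈ uIcc 0 Real.pi := by
    rw [uIcc_of_le Real.pi_pos.le]; exact Ioo_subset_Icc_self hx'
  exact (hx hx'' 0 (by simp)).deriv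

/-- Integration by parts against a smooth function. -/
lemma parts {u θ : ℝ → ℝ} (hu : AbsolutelyContinuousOnInterval u 0 Real.pi)
    (hθ : ContDiff ℝ ∞ θ) {f g : ℝ → ℝ} (hf : f =ᵐ[leb] u) (hg : g =ᵐ[leb] deriv u) :
    ∫ x in Ioo 0 Real.pi, f x * deriv θ x =
      u Real.pi * θ Real.pi - u 0 * θ 0 - ∫ x in Ioo 0 Real.pi, g x * θ x := by
  have h1 : ∫ x in Ioo 0 Real.pi, f x * deriv θ x = ∫ x in Ioo 0 Real.pi, u x * deriv θ x :=
    integral_congr_ae (by filter_upwards [hf] with x hx; rw [hx])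
  have h2 : ∫ x in Ioo 0 Real.pi, g x * θ x = ∫ x in Ioo 0 Real.pi, deriv u x * θ x :=
    integral_congr_ae (by filter_upwards [hg] with x hx; rw [hx])
  rw [h1, h2, setIntegral_eq, setIntegral_eq]
  exact hu.integral_mul_deriv_eq_deriv_mul
    ((hθ.of_le (by exact_mod_cast le_top)).contDiffOn.absolutelyContinuousOnInterval)

/-- An absolutely continuous function has its pointwise derivative as weak derivative. -/
lemma hasWeakDeriv_of_ac {u : ℝ → ℝ} (hu : AbsolutelyContinuousOnInterval u 0 Real.pi)
    {f g : L2} (hf : f =ᵐ[leb] u) (hg : g =ᵐ[leb] deriv u) : HasWeakDeriv f g := by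
  intro θ hθ _ hs
  have h0 : θ 0 = 0 := image_eq_zero_of_notMem_tsupport fun h => by simpa using (hs h).1
  have h1 : θ Real.pi = 0 := image_eq_zero_of_notMem_tsupport fun h => by simpa using (hs h).2
  rw [parts hu hθ hf hg, h0, h1]; ring

/-- The lemma of du Bois-Reymond. -/
lemma HasWeakDeriv.ae_eq {f g : L2} (h : HasWeakDeriv f g) :
    ∃ c : ℝ, f =ᵐ[leb] fun x => c + primitive g x := by
  have hpi := Real.pi_pos
  let w : ℝ → ℝ := fun x => f x - primitive g x
  have hw : IntegrableOn w (Ioo 0 Real.pi) volume :=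
    ((Lp.memLp f).integrable (by norm_num)).sub
      ((memLp_of_continuousOn (primitive_continuousOn g)).integrable (by norm_num))
  have hwb : ∀ ψ : ℝ → ℝ, Continuous ψ →
      IntegrableOn (fun x => w x * ψ x) (Ioo 0 Real.pi) volume := by
    intro ψ hψ
    obtain ⟨C, hC⟩ := (isCompact_Icc (a := (0 : ℝ)) (b := Real.pi)).exists_bound_of_continuousOn
      hψ.continuousOn
    refine Integrable.mul_bdd (c := C) hw hψ.aestronglyMeasurable ?_
    filter_upwards [ae_restrict_mem measurableSet_Ioo] with x hx
    exact hC x (Ioo_subset_Icc_self hx)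
  -- `w` annihilates derivatives of test functions
  have key : ∀ θ : ℝ → ℝ, ContDiff ℝ ∞ θ → HasCompactSupport θ → tsupport θ ⊆ Ioo 0 Real.pi →
      ∫ x in Ioo 0 Real.pi, w x * deriv θ x = 0 := by
    intro θ hθ hc hs
    have h0 : θ 0 = 0 := image_eq_zero_of_notMem_tsupport fun h => by simpa using (hs h).1
    have h1 : θ Real.pi = 0 := image_eq_zero_of_notMem_tsupport fun h => by simpa using (hs h).2
    have e1 := h θ hθ hc hs
    have e2 := parts (primitive_ac g) hθ (f := primitive g) (g := g) (Filter.EventuallyEq.rfl)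
      (primitive_deriv g).symm
    have hd : Continuous (deriv θ) := hθ.continuous_deriv (by simp)
    obtain ⟨C, hC⟩ := (isCompact_Icc (a := (0 : ℝ)) (b := Real.pi)).exists_bound_of_continuousOn
      hd.continuousOn
    have hb : ∀ᵐ x ∂leb, ‖deriv θ x‖ ≤ C := by
      filter_upwards [ae_restrict_mem measurableSet_Ioo] with x hx
      exact hC x (Ioo_subset_Icc_self hx)
    have i1 : Integrable (fun x => f x * deriv θ x) leb :=
      Integrable.mul_bdd (c := C) ((Lp.memLp f).integrable (by norm_num))
        hd.aestronglyMeasurable hb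
    have i2 : Integrable (fun x => primitive g x * deriv θ x) leb :=
      Integrable.mul_bdd (c := C)
        ((memLp_of_continuousOn (primitive_continuousOn g)).integrable (by norm_num))
        hd.aestronglyMeasurable hb
    simp only [w, sub_mul]
    rw [integral_sub i1 i2, e1, e2, h0, h1]; ring
  -- a bump function
  let η : ContDiffBump (Real.pi / 2) := ⟨Real.pi / 8, Real.pi / 4, by linarith, by linarith⟩
  have hηs : tsupport η ⊆ Icc (Real.pi / 4) (3 * Real.pi / 4) := by
    rw [η.tsupport_eq, Real.closedBall_eq_Icc]
    apply Icc_subset_Icc <;> simp only [η] <;> linarith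
  have hηI : 0 < ∫ x, η x := η.integral_pos
  set c : ℝ := (∫ x in Ioo 0 Real.pi, w x * η x) / ∫ x, η x with hcdef
  refine ⟨c, ?_⟩
  have main := isOpen_Ioo (a := (0 : ℝ)) (b := Real.pi) |>.ae_eq_zero_of_integral_contDiff_smul_eq_zero
    (μ := volume) (f := fun x => w x - c)
    (IntegrableOn.locallyIntegrableOn (hw.sub (integrableOn_const (by simp)))) ?_
  · rw [Filter.EventuallyEq, ae_restrict_iff' measurableSet_Ioo]
    filter_upwards [main] with x hx hx'
    have := hx hx'
    simp only [w] at this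
    linarith
  intro ψ hψ hψc hψs
  -- the test function with derivative `ψ - (∫ ψ / ∫ η) η`
  set r : ℝ := (∫ x, ψ x) / ∫ x, η x with hr
  let ψ' : ℝ → ℝ := fun x => ψ x - r * η x
  have hψ' : ContDiff ℝ ∞ ψ' := hψ.sub (contDiff_const.mul η.contDiff)
  have hiψ : Integrable ψ volume := hψ.continuous.integrable_of_hasCompactSupport hψc
  have hiη : Integrable (fun x => η x) volume :=
    η.continuous.integrable_of_hasCompactSupport η.hasCompactSupport
  have hi' : ∫ x, ψ' x = 0 := by
    simp only [ψ']
    rw [integral_sub hiψ (hiη.const_mul r), integral_const_mul, hr]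
    field_simp; ring
  obtain ⟨a, b, ha, hab, hb, hsup⟩ : ∃ a b : ℝ, 0 < a ∧ a ≤ b ∧ b < Real.pi ∧
      ∀ x, x ∉ Icc a b → ψ' x = 0 := by
    let K := tsupport ψ ∪ Icc (Real.pi / 4) (3 * Real.pi / 4)
    have hK : IsCompact K := hψc.isCompact.union isCompact_Icc
    have hne : K.Nonempty := ⟨Real.pi / 2, Or.inr ⟨by linarith, by linarith⟩⟩
    have hKs : K ⊆ Ioo 0 Real.pi := union_subset hψs fun x hx =>
      ⟨by linarith [hx.1], by linarith [hx.2]⟩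
    obtain ⟨a, ha⟩ := hK.exists_isLeast hne
    obtain ⟨b, hb⟩ := hK.exists_isGreatest hne
    refine ⟨a, b, (hKs ha.1).1, ha.2 hb.1, (hKs hb.1).2, fun x hx => ?_⟩
    have hxK : x ∉ K := fun h => hx ⟨ha.2 h, hb.2 h⟩
    have e1 : ψ x = 0 := image_eq_zero_of_notMem_tsupport fun h => hxK (Or.inl h)
    have e2 : η x = 0 := image_eq_zero_of_notMem_tsupport fun h => hxK (Or.inr (hηs h))
    simp [ψ', e1, e2]
  let θ : ℝ → ℝ := fun x => ∫ t in a..x, ψ' t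
  have hθd : ∀ x, HasDerivAt θ (ψ' x) x := fun x =>
    intervalIntegral.integral_hasDerivAt_right (hψ'.continuous.intervalIntegrable _ _)
      (hψ'.continuous.stronglyMeasurableAtFilter _ _) hψ'.continuous.continuousAt
  have hθ' : deriv θ = ψ' := funext fun x => (hθd x).deriv
  have hθ : ContDiff ℝ ∞ θ := by
    rw [contDiff_infty_iff_deriv, hθ']
    exact ⟨fun x => (hθd x).differentiableAt, hψ'⟩
  have hab0 : ∫ t in a..b, ψ' t = 0 := by
    rw [intervalIntegral.integral_of_le hab, ← integral_Icc_eq_integral_Ioc,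
      setIntegral_eq_integral_of_forall_compl_eq_zero hsup, hi']
  have hθ0 : ∀ x, x ∉ Icc a b → θ x = 0 := by
    intro x hx
    rw [mem_Icc, not_and_or, not_le, not_le] at hx
    rcases hx with hx | hx
    · have : ∀ t ∈ uIcc a x, t ≠ a → ψ' t = 0 := by
        intro t ht hta
        rw [uIcc_of_ge hx.le] at ht
        exact hsup t fun h => hta (le_antisymm ht.2 h.1)
      have hz : ∫ t in a..x, ψ' t = ∫ t in a..x, (0 : ℝ) := by
        apply intervalIntegral.integral_congr_ae
        have : ∀ᵐ t : ℝ, t ≠ a := by simp [ae_iff]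
        filter_upwards [this] with t hta ht
        exact ‹∀ t ∈ uIcc a x, t ≠ a → ψ' t = 0› t (uIoc_subset_uIcc ht) hta
      simp [θ, hz]
    · have hz : ∫ t in b..x, ψ' t = ∫ t in b..x, (0 : ℝ) := by
        apply intervalIntegral.integral_congr_ae
        refine Filter.Eventually.of_forall fun t ht => ?_
        rw [uIoc_of_le hx.le] at ht
        exact hsup t fun h => absurd ht.1 (not_lt.2 h.2)
      have := intervalIntegral.integral_add_adjacent_intervals
        (hψ'.continuous.intervalIntegrable (μ := volume) a b)
        (hψ'.continuous.intervalIntegrable (μ := volume) b x)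
      simp only [θ]
      rw [← this, hab0, hz]; simp
  have hθs : tsupport θ ⊆ Icc a b :=
    closure_minimal (fun x hx => by_contra fun h => hx (hθ0 x h)) isClosed_Icc
  have hk := key θ hθ (HasCompactSupport.of_support_subset_isCompact isCompact_Icc
    ((subset_tsupport θ).trans hθs)) (hθs.trans fun x hx => ⟨ha.trans_le hx.1, hx.2.trans_lt hb⟩)
  rw [hθ'] at hk
  simp only [ψ', mul_sub] at hk
  have hreta : IntegrableOn (fun x => w x * (r * η x)) (Ioo 0 Real.pi) volume :=
    hwb (fun x => r * η x) (continuous_const.mul η.continuous)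
  rw [integral_sub (hwb ψ hψ.continuous) hreta] at hk
  have e3 : ∫ x in Ioo 0 Real.pi, w x * (r * η x) = r * ∫ x in Ioo 0 Real.pi, w x * η x := by
    rw [← integral_const_mul]; congr 1; ext x; ring
  rw [e3] at hk
  have e4 : ∫ x, ψ x • (w x - c) = ∫ x in Ioo 0 Real.pi, (w x * ψ x - c * ψ x) := by
    rw [← setIntegral_eq_integral_of_forall_compl_eq_zero (s := Ioo 0 Real.pi)]
    · congr 1; ext x; simp only [smul_eq_mul]; ring
    · intro x hx
      have : ψ x = 0 := image_eq_zero_of_notMem_tsupport fun h => hx (hψs h)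
      simp [this]
  have e5 : ∫ x in Ioo 0 Real.pi, ψ x = ∫ x, ψ x :=
    setIntegral_eq_integral_of_forall_compl_eq_zero fun x hx =>
      image_eq_zero_of_notMem_tsupport fun h => hx (hψs h)
  rw [e4, integral_sub (hwb ψ hψ.continuous) (hiψ.integrableOn.const_mul c), integral_const_mul,
    e5]
  have : c * ∫ x, ψ x = r * ∫ x in Ioo 0 Real.pi, w x * η x := by
    rw [hcdef, hr]; ring
  linarith

/-- A pair `(f, f_x)` with zero boundary values is determined by the primitive of `f_x`. -/
lemma primitive_of_zeroTrace {f g : L2} (h : HasWeakDeriv f g) (h0 : HasZeroTrace f) :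
    f =ᵐ[leb] primitive g ∧ primitive g Real.pi = 0 := by
  obtain ⟨c, hc⟩ := h.ae_eq
  obtain ⟨u, hu, hu0, hu1, hfu⟩ := h0
  have he : EqOn u (fun x => c + primitive g x) (Icc 0 Real.pi) := by
    refine Measure.eqOn_Icc_of_ae_eq volume Real.pi_pos.ne ?_ hu
      (continuousOn_const.add (primitive_continuousOn g))
    rw [← restrict_Ioo_eq_restrict_Icc]
    exact hfu.symm.trans hc
  have h1 := he (left_mem_Icc.2 Real.pi_pos.le)
  have h2 := he (right_mem_Icc.2 Real.pi_pos.le)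
  simp only [primitive_zero, hu0, hu1] at h1 h2
  have hc0 : c = 0 := by linarith
  subst hc0
  exact ⟨by simpa using hc, by linarith⟩

lemma zeroTrace_of_primitive {f g : L2} (h : f =ᵐ[leb] primitive g)
    (h1 : primitive g Real.pi = 0) : HasWeakDeriv f g ∧ HasZeroTrace f :=
  ⟨hasWeakDeriv_of_ac (primitive_ac g) h (primitive_deriv g).symm,
    primitive g, primitive_continuousOn g, primitive_zero g, h1, h⟩

lemma integrable_L2_mul (f : L2) {θ : ℝ → ℝ} (hθ : Continuous θ) :
    Integrable (fun x => f x * θ x) leb :=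
  MemLp.integrable_mul (p := 2) (q := 2) (Lp.memLp f) (memLp_of_continuousOn hθ.continuousOn)

/-- The Sobolev space `H¹₀(0, π)`. An element is a pair `(f, f_x)` of functions in `L²(0, π)`, the
second being the distributional derivative of the first, where the continuous representative of
`f` vanishes at both ends. As a subspace of the `ℓ²`-product `L² × L²` it carries the inner product
`⟨f, g⟩_{L²} + ⟨f_x, g_x⟩_{L²}`. -/
def H10 : Submodule ℝ (WithLp 2 (L2 × L2)) where
  carrier := {v | HasWeakDeriv v.fst v.snd ∧ HasZeroTrace v.fst}
  zero_mem' := by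
    refine ⟨fun θ _ _ _ => ?_, fun _ => 0, continuousOn_const, rfl, rfl, Lp.coeFn_zero _ _ _⟩
    have h1 : ∀ θ : ℝ → ℝ, ∫ x in Ioo 0 Real.pi, (0 : L2) x * θ x = 0 := fun θ => by
      rw [integral_congr_ae (g := fun _ => (0 : ℝ)), integral_zero]
      filter_upwards [Lp.coeFn_zero ℝ 2 leb] with x hx
      rw [hx]; simp
    have := h1 (deriv θ)
    have := h1 θ
    simp_all
  add_mem' := by
    rintro v w ⟨hv, u, huc, hu0, hu1, hu⟩ ⟨hw, u', huc', hu0', hu1', hu'⟩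
    refine ⟨fun θ h1 h2 h3 => ?_, fun x => u x + u' x, huc.add huc', by simp [hu0, hu0'],
      by simp [hu1, hu1'], ?_⟩
    · have e : ∀ (a b : L2) (ζ : ℝ → ℝ), Continuous ζ → ∫ x in Ioo 0 Real.pi, (a + b : L2) x * ζ x =
          (∫ x in Ioo 0 Real.pi, a x * ζ x) + ∫ x in Ioo 0 Real.pi, b x * ζ x := by
        intro a b ζ hζ
        rw [← integral_add (integrable_L2_mul a hζ) (integrable_L2_mul b hζ)]
        apply integral_congr_ae
        filter_upwards [Lp.coeFn_add a b] with x hx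
        rw [hx, Pi.add_apply, add_mul]
      rw [WithLp.add_fst, WithLp.add_snd, e _ _ _ (h1.continuous_deriv (by simp)),
        e _ _ _ h1.continuous, hv θ h1 h2 h3, hw θ h1 h2 h3]
      ring
    · rw [WithLp.add_fst]
      filter_upwards [Lp.coeFn_add v.fst w.fst, hu, hu'] with x hx h1 h2
      rw [hx, Pi.add_apply, h1, h2]
  smul_mem' := by
    rintro c v ⟨hv, u, huc, hu0, hu1, hu⟩
    refine ⟨fun θ h1 h2 h3 => ?_, fun x => c * u x, continuousOn_const.mul huc, by simp [hu0],
      by simp [hu1], ?_⟩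
    · have e : ∀ (a : L2) (ζ : ℝ → ℝ), ∫ x in Ioo 0 Real.pi, (c • a : L2) x * ζ x =
          c * ∫ x in Ioo 0 Real.pi, a x * ζ x := by
        intro a ζ
        rw [← integral_const_mul]
        apply integral_congr_ae
        filter_upwards [Lp.coeFn_smul c a] with x hx
        rw [hx, Pi.smul_apply, smul_eq_mul, mul_assoc]
      rw [WithLp.smul_fst, WithLp.smul_snd, e, e, hv θ h1 h2 h3]
      ring
    · rw [WithLp.smul_fst]
      filter_upwards [Lp.coeFn_smul c v.fst, hu] with x hx h1
      rw [hx, Pi.smul_apply, h1, smul_eq_mul]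

/-- The underlying `L²` function of an element of `H¹₀(0, π)`. -/
def fn (f : H10) : L2 := (f : WithLp 2 (L2 × L2)).fst

/-- The derivative of an element of `H¹₀(0, π)`. -/
def der (f : H10) : L2 := (f : WithLp 2 (L2 × L2)).snd

/-- Membership in `H¹₀(0, π)` through the Green formula with arbitrary smooth test functions. -/
lemma mem_H10_iff (v : WithLp 2 (L2 × L2)) : v ∈ H10 ↔ ∀ θ : ℝ → ℝ, ContDiff ℝ ∞ θ →
    ∫ x in Ioo 0 Real.pi, v.fst x * deriv θ x = -∫ x in Ioo 0 Real.pi, v.snd x * θ x := by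
  constructor
  · rintro ⟨h1, h2⟩ θ hθ
    obtain ⟨h3, h4⟩ := primitive_of_zeroTrace h1 h2
    rw [parts (primitive_ac v.snd) hθ h3 (primitive_deriv v.snd).symm, h4, primitive_zero]
    ring
  · intro h
    have hw : HasWeakDeriv v.fst v.snd := fun θ hθ _ _ => h θ hθ
    obtain ⟨c, hc⟩ := hw.ae_eq
    have hp : primitive v.snd Real.pi = 0 := by
      have := h (fun _ => 1) contDiff_const
      simp only [deriv_const, mul_zero, integral_zero, mul_one, setIntegral_eq] at this
      simpa [primitive] using this
    have hid := h (fun x => x) contDiff_id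
    rw [parts (θ := fun x => x) (primitive_ac v.snd |>.add
      (contDiff_const (c := c) |>.contDiffOn.absolutelyContinuousOnInterval)) contDiff_id
      (f := v.fst) (g := v.snd)
      (by filter_upwards [hc] with x hx; simp [hx, add_comm]) ?_] at hid
    · simp [hp, primitive_zero] at hid
      have hc0 : c = 0 := hid
      subst hc0
      exact zeroTrace_of_primitive (by simpa using hc) hp
    · filter_upwards [primitive_deriv v.snd] with x hx
      have : deriv (primitive v.snd + fun _ => c) x = deriv (primitive v.snd) x := by
        have : (primitive v.snd + fun _ => c) = fun y => primitive v.snd y + c := rfl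
        rw [this, deriv_add_const]
      rw [this, hx]

lemma integral_mul_eq_inner (f : L2) {θ : ℝ → ℝ} (hθ : Continuous θ) :
    ∫ x in Ioo 0 Real.pi, f x * θ x =
      inner ℝ ((memLp_of_continuousOn hθ.continuousOn).toLp θ) f := by
  rw [L2.inner_def]
  apply integral_congr_ae
  filter_upwards [(memLp_of_continuousOn hθ.continuousOn).coeFn_toLp] with x hx
  simp [hx]

lemma isClosed_H10 : IsClosed (H10 : Set (WithLp 2 (L2 × L2))) := by
  have : (H10 : Set (WithLp 2 (L2 × L2))) = ⋂ (θ : ℝ → ℝ) (hθ : ContDiff ℝ ∞ θ),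
      {v | inner ℝ ((memLp_of_continuousOn
          (hθ.continuous_deriv (by simp)).continuousOn).toLp (deriv θ)) v.fst =
        -inner ℝ ((memLp_of_continuousOn hθ.continuous.continuousOn).toLp θ) v.snd} := by
    ext v
    simp only [SetLike.mem_coe, mem_H10_iff, mem_iInter, mem_ofPred_eq]
    refine forall_congr' fun θ => forall_congr' fun hθ => ?_
    rw [integral_mul_eq_inner _ (hθ.continuous_deriv (by simp)),
      integral_mul_eq_inner _ hθ.continuous]
  rw [this]
  refine isClosed_iInter fun θ => isClosed_iInter fun hθ => isClosed_eq ?_ ?_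
  · exact continuous_const.inner (WithLp.prod_continuous_ofLp 2 _ _).fst
  · exact (continuous_const.inner (WithLp.prod_continuous_ofLp 2 _ _).snd).neg

instance : CompleteSpace H10 := isClosed_H10.completeSpace_coe

/-- An absolutely continuous function that vanishes at both ends and has its derivative in `L²`,
as an element of `H¹₀(0, π)`. -/
lemma mem_of_ac {u : ℝ → ℝ} (hu : AbsolutelyContinuousOnInterval u 0 Real.pi) (h0 : u 0 = 0)
    (h1 : u Real.pi = 0) {f g : ℝ → ℝ} (hf : MemLp f 2 leb) (hg : MemLp g 2 leb)
    (hfu : f =ᵐ[leb] u) (hgu : g =ᵐ[leb] deriv u) :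
    WithLp.toLp 2 (hf.toLp f, hg.toLp g) ∈ H10 := by
  have hc : ContinuousOn u (Icc 0 Real.pi) := by
    have := hu.continuousOn
    rwa [uIcc_of_le Real.pi_pos.le] at this
  exact ⟨hasWeakDeriv_of_ac hu (hf.coeFn_toLp.trans hfu) (hg.coeFn_toLp.trans hgu),
    u, hc, h0, h1, hf.coeFn_toLp.trans hfu⟩

lemma memLp_sin (k : ℕ) : MemLp (fun x => √(2 / Real.pi) * Real.sin (k * x)) 2 leb :=
  memLp_of_continuousOn (by fun_prop)

lemma memLp_cos (k : ℕ) : MemLp (fun x => √(2 / Real.pi) * (k * Real.cos (k * x))) 2 leb :=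
  memLp_of_continuousOn (by fun_prop)

/-- The function `s_k(x) = √(2/π) sin (k x)` in `H¹₀(0, π)`. -/
def sine (k : ℕ) : H10 :=
  ⟨WithLp.toLp 2 ((memLp_sin k).toLp _, (memLp_cos k).toLp _), by
    refine mem_of_ac (u := fun x => √(2 / Real.pi) * Real.sin (k * x)) ?_ (by simp)
      (by simp [Real.sin_nat_mul_pi]) _ _ Filter.EventuallyEq.rfl ?_
    · exact ContDiffOn.absolutelyContinuousOnInterval (by fun_prop)
    · refine Filter.Eventually.of_forall fun x => ?_
      have : HasDerivAt (fun x : ℝ => √(2 / Real.pi) * Real.sin (k * x))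
          (√(2 / Real.pi) * (Real.cos (k * x) * (k * 1))) x :=
        (((hasDerivAt_id x).const_mul (k : ℝ)).sin).const_mul _
      rw [this.deriv]; ring⟩

/-- The heat semigroup `U(t) f = ∑_{k ≥ 1} exp (-k² t) ⟨s_k, f⟩_{L²} s_k`, for `t ≥ 0`, the series
being convergent in `H¹₀(0, π)`. -/
def heat (t : ℝ) (f : H10) : H10 :=
  ∑' k : ℕ, (Real.exp (-((k + 1 : ℕ) : ℝ) ^ 2 * t) *
    (inner ℝ (fn (sine (k + 1))) (fn f) : ℝ)) • sine (k + 1)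

lemma pow_facts (p : ℕ) (f : H10) :
    MemLp (fun x => fn f x ^ p) 2 leb ∧
    MemLp (fun x => p * fn f x ^ (p - 1) * der f x) 2 leb ∧
    AbsolutelyContinuousOnInterval (fun x => primitive (der f) x ^ p) 0 Real.pi ∧
    (fun x => fn f x ^ p) =ᵐ[leb] (fun x => primitive (der f) x ^ p) ∧
    (fun x => p * fn f x ^ (p - 1) * der f x) =ᵐ[leb] deriv (fun x => primitive (der f) x ^ p) ∧
    primitive (der f) Real.pi = 0 := by
  obtain ⟨h1, h2⟩ := primitive_of_zeroTrace f.2.1 f.2.2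
  change fn f =ᵐ[leb] primitive (der f) at h1
  have hc := primitive_continuousOn (der f)
  have hac : ∀ n : ℕ, AbsolutelyContinuousOnInterval (fun x => primitive (der f) x ^ n) 0 Real.pi := by
    intro n
    induction n with
    | zero =>
      simpa using (contDiff_const (c := (1 : ℝ))).contDiffOn.absolutelyContinuousOnInterval
    | succ n ih => simpa [pow_succ] using ih.fun_mul (primitive_ac (der f))
  have hfe : (fun x => fn f x ^ p) =ᵐ[leb] (fun x => primitive (der f) x ^ p) := by
    filter_upwards [h1] with x hx; rw [hx]
  refine ⟨?_, ?_, hac p, hfe, ?_, h2⟩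
  · exact (memLp_congr_ae hfe).2 (memLp_of_continuousOn (hc.pow p))
  · have hge : (fun x => p * fn f x ^ (p - 1) * der f x) =ᵐ[leb]
        (fun x => (p * primitive (der f) x ^ (p - 1)) * der f x) := by
      filter_upwards [h1] with x hx; rw [hx]
    rw [memLp_congr_ae hge]
    have hcc : ContinuousOn (fun x => p * primitive (der f) x ^ (p - 1)) (Icc 0 Real.pi) :=
      continuousOn_const.mul (hc.pow _)
    obtain ⟨C, hC⟩ := isCompact_Icc.exists_bound_of_continuousOn hcc
    refine MemLp.of_le_mul (c := C) (Lp.memLp (der f))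
      ((memLp_of_continuousOn hcc).aestronglyMeasurable.mul (Lp.aestronglyMeasurable _)) ?_
    filter_upwards [ae_restrict_mem measurableSet_Ioo] with x hx
    rw [norm_mul]
    exact mul_le_mul_of_nonneg_right (hC x (Ioo_subset_Icc_self hx)) (norm_nonneg _)
  · have hd := (primitive_ac (der f)).ae_differentiableAt
    have hd' : ∀ᵐ x ∂leb, DifferentiableAt ℝ (primitive (der f)) x := by
      rw [ae_restrict_iff' measurableSet_Ioo]
      filter_upwards [hd] with x hx hx'
      exact hx (by rw [uIcc_of_le Real.pi_pos.le]; exact Ioo_subset_Icc_self hx')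
    filter_upwards [h1, primitive_deriv (der f), hd'] with x hx hx' hx''
    rw [(hx''.hasDerivAt.fun_pow p).deriv, hx, hx']

lemma coeFn_sine (k : ℕ) :
    fn (sine k) =ᵐ[leb] fun x => √(2 / Real.pi) * Real.sin (k * x) := (memLp_sin k).coeFn_toLp

lemma coeFn_der_sine (k : ℕ) :
    der (sine k) =ᵐ[leb] fun x => √(2 / Real.pi) * (k * Real.cos (k * x)) :=
  (memLp_cos k).coeFn_toLp

lemma inner_H10 (f g : H10) :
    inner ℝ f g = inner ℝ (fn f) (fn g) + inner ℝ (der f) (der g) := rfl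

lemma inner_sine (k : ℕ) (f : H10) :
    inner ℝ (sine k) f = (1 + (k : ℝ) ^ 2) * inner ℝ (fn (sine k)) (fn f) := by
  have hd : ∀ x : ℝ, deriv (fun x : ℝ => √(2 / Real.pi) * (k * Real.cos (k * x))) x =
      -(k : ℝ) ^ 2 * (√(2 / Real.pi) * Real.sin (k * x)) := fun x => by
    have : HasDerivAt (fun x : ℝ => √(2 / Real.pi) * (k * Real.cos (k * x)))
        (√(2 / Real.pi) * (k * (-Real.sin (k * x) * (k * 1)))) x :=
      ((((hasDerivAt_id x).const_mul (k : ℝ)).cos).const_mul _).const_mul _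
    rw [this.deriv]; ring
  have h := (mem_H10_iff f).1 f.2 (fun x => √(2 / Real.pi) * (k * Real.cos (k * x)))
    (by fun_prop)
  have e1 : inner ℝ (fn (sine k)) (fn f) =
      ∫ x in Ioo 0 Real.pi, fn f x * (√(2 / Real.pi) * Real.sin (k * x)) := by
    rw [L2.inner_def]
    apply integral_congr_ae
    filter_upwards [coeFn_sine k] with x hx
    simp [hx]
  have e2 : inner ℝ (der (sine k)) (der f) =
      ∫ x in Ioo 0 Real.pi, der f x * (√(2 / Real.pi) * (k * Real.cos (k * x))) := by
    rw [L2.inner_def]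
    apply integral_congr_ae
    filter_upwards [coeFn_der_sine k] with x hx
    simp [hx]
  have e3 : ∫ x in Ioo 0 Real.pi, fn f x *
      deriv (fun x : ℝ => √(2 / Real.pi) * (k * Real.cos (k * x))) x =
      -(k : ℝ) ^ 2 * inner ℝ (fn (sine k)) (fn f) := by
    rw [e1, ← integral_const_mul]
    congr 1; ext x; rw [hd]; ring
  have e4 : inner ℝ (der (sine k)) (der f) = (k : ℝ) ^ 2 * inner ℝ (fn (sine k)) (fn f) := by
    rw [e2]
    change ∫ x in Ioo 0 Real.pi, fn f x *
      deriv (fun x : ℝ => √(2 / Real.pi) * (k * Real.cos (k * x))) x = _ at h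
    rw [e3] at h
    change _ = -∫ x in Ioo 0 Real.pi, der f x * _ at h
    linarith
  rw [inner_H10, e4]; ring

lemma inner_sine_sine {j k : ℕ} (h : j ≠ k) : inner ℝ (sine j) (sine k) = 0 := by
  have h1 := inner_sine j (sine k)
  have h2 := inner_sine k (sine j)
  rw [real_inner_comm, h1, real_inner_comm] at h2
  have h3 : ((j : ℝ) ^ 2 - (k : ℝ) ^ 2) * inner ℝ (fn (sine k)) (fn (sine j)) = 0 := by linarith
  have h4 : (j : ℝ) ^ 2 - (k : ℝ) ^ 2 ≠ 0 := by
    rw [sub_ne_zero]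
    intro he
    exact h (by exact_mod_cast (pow_left_inj₀ (by positivity) (by positivity) two_ne_zero).1 he)
  rw [h1, real_inner_comm, (mul_eq_zero.1 h3).resolve_left h4, mul_zero]

lemma norm_fn_sine {k : ℕ} (hk : k ≠ 0) : inner ℝ (fn (sine k)) (fn (sine k)) = 1 := by
  have hk' : (k : ℝ) ≠ 0 := by exact_mod_cast hk
  have e : inner ℝ (fn (sine k)) (fn (sine k)) =
      ∫ x in Ioo 0 Real.pi, 2 / Real.pi * Real.sin (k * x) ^ 2 := by
    rw [L2.inner_def]
    apply integral_congr_ae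
    filter_upwards [coeFn_sine k] with x hx
    have h2 : √(2 / Real.pi) * √(2 / Real.pi) = 2 / Real.pi :=
      Real.mul_self_sqrt (by have := Real.pi_pos; positivity)
    simp only [hx, RCLike.inner_apply, conj_trivial]
    rw [show √(2 / Real.pi) * Real.sin (k * x) * (√(2 / Real.pi) * Real.sin (k * x)) =
      √(2 / Real.pi) * √(2 / Real.pi) * Real.sin (k * x) ^ 2 by ring, h2]
  rw [e, integral_const_mul, setIntegral_eq,
    intervalIntegral.integral_comp_mul_left (fun y => Real.sin y ^ 2) hk', integral_sin_sq]
  simp [Real.sin_nat_mul_pi]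
  field_simp

/-- The series that defines `heat t f` converges. -/
lemma heat_summable {t : ℝ} (ht : 0 ≤ t) (f : H10) :
    Summable fun k : ℕ => (Real.exp (-((k + 1 : ℕ) : ℝ) ^ 2 * t) *
      (inner ℝ (fn (sine (k + 1))) (fn f) : ℝ)) • sine (k + 1) := by
  let r : ℕ → ℝ := fun k => (√(1 + ((k + 1 : ℕ) : ℝ) ^ 2))⁻¹
  have hr : ∀ k, r k * r k * (1 + ((k + 1 : ℕ) : ℝ) ^ 2) = 1 := fun k => by
    have h0 : (0 : ℝ) < 1 + ((k + 1 : ℕ) : ℝ) ^ 2 := by positivity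
    simp only [r]
    rw [← mul_inv, Real.mul_self_sqrt h0.le, inv_mul_cancel₀ h0.ne']
  let v : ℕ → H10 := fun k => r k • sine (k + 1)
  have hv : Orthonormal ℝ v := by
    rw [orthonormal_iff_ite]
    intro i j
    simp only [v]
    rw [real_inner_smul_left (sine (i + 1)) _ (r i), real_inner_smul_right _ (sine (j + 1)) (r j)]
    split_ifs with h
    · subst h
      rw [inner_sine, norm_fn_sine (by omega), mul_one, ← mul_assoc, hr]
    · rw [inner_sine_sine (by omega)]; simp
  have hterm : ∀ k, (Real.exp (-((k + 1 : ℕ) : ℝ) ^ 2 * t) *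
      (inner ℝ (fn (sine (k + 1))) (fn f) : ℝ)) • sine (k + 1) =
      LinearIsometry.toSpanSingleton ℝ H10 (hv.1 k)
        (Real.exp (-((k + 1 : ℕ) : ℝ) ^ 2 * t) * inner ℝ (v k) f) := by
    intro k
    rw [LinearIsometry.toSpanSingleton_apply]
    simp only [v]
    rw [real_inner_smul_left (sine (k + 1)) f (r k), inner_sine, smul_smul]
    congr 1
    linear_combination (-(Real.exp (-((k + 1 : ℕ) : ℝ) ^ 2 * t) *
      (inner ℝ (fn (sine (k + 1))) (fn f) : ℝ))) * hr k
  simp only [hterm]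
  rw [(hv.orthogonalFamily).summable_iff_norm_sq_summable
    (fun k => Real.exp (-((k + 1 : ℕ) : ℝ) ^ 2 * t) * inner ℝ (v k) f)]
  refine Summable.of_nonneg_of_le (fun k => by positivity) (fun k => ?_)
    (hv.inner_products_summable f)
  rw [norm_mul, mul_pow]
  refine mul_le_of_le_one_left (by positivity) (pow_le_one₀ (norm_nonneg _) ?_)
  rw [Real.norm_eq_abs, Real.abs_exp, Real.exp_le_one_iff]
  have : 0 ≤ ((k + 1 : ℕ) : ℝ) ^ 2 * t := by positivity
  linarith

/-- The nonlinearity `P(f) = f ^ p`, the pointwise power, as a map of `H¹₀(0, π)` into itself. -/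
def powMap {p : ℕ} (hp : 2 ≤ p) (f : H10) : H10 :=
  ⟨WithLp.toLp 2 ((pow_facts p f).1.toLp _, (pow_facts p f).2.1.toLp _), by
    have h := pow_facts p f
    have hp0 : p ≠ 0 := by omega
    exact mem_of_ac h.2.2.1 (by simp [primitive_zero, hp0]) (by simp [h.2.2.2.2.2, hp0]) _ _
      h.2.2.2.1 h.2.2.2.2.1⟩

/-- `J` is an interval with left end `0`, included, and nonempty interior, either without or with
its right end: `[0, T)` with `0 < T ≤ +∞`, or `[0, T]` with `0 < T < +∞`. -/
def IsTimeInterval (J : Set ℝ) : Prop :=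
  J = Ici 0 ∨ ∃ T : ℝ, 0 < T ∧ (J = Ico 0 T ∨ J = Icc 0 T)

/-- `φ`, considered on `J`, is a solution with datum `f₀` of the Volterra problem
`φ(t) = U(t) f₀ + ∫₀ᵗ U(t - s) φ(s)^p ds`, the integral being the one of continuous functions with
values in `H¹₀(0, π)`. -/
structure IsSolution {p : ℕ} (hp : 2 ≤ p) (f₀ : H10) (J : Set ℝ) (φ : ℝ → H10) : Prop where
  interval : IsTimeInterval J
  continuousOn : ContinuousOn φ J
  volterra : ∀ t ∈ J, φ t = heat t f₀ + ∫ s in (0)..t, heat (t - s) (powMap hp (φ s))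

/-- A maximal solution is a solution without proper extension. -/
def IsMaximalSolution {p : ℕ} (hp : 2 ≤ p) (f₀ : H10) (J : Set ℝ) (φ : ℝ → H10) : Prop :=
  IsSolution hp f₀ J φ ∧
    ∀ (J' : Set ℝ) (ψ : ℝ → H10), IsSolution hp f₀ J' ψ → J ⊆ J' → EqOn φ ψ J → J' = J

/-- The time interval `[0, ϑ)`, where `ϑ` may be `+∞`. -/
def timeInterval (ϑ : EReal) : Set ℝ := {t | 0 ≤ t ∧ (t : EReal) < ϑ}

/-- The supremum of the `T ∈ (0, +∞]` for which there is a solution on `[0, T)`. It is the right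
end of the domain of the maximal solution. -/
def existenceTime {p : ℕ} (hp : 2 ≤ p) (f₀ : H10) : EReal :=
  sSup {T : EReal | 0 < T ∧ ∃ φ : ℝ → H10, IsSolution hp f₀ (timeInterval T) φ}

/-- `Q(f) = ½ ∫₀^π sin x f(x) dx`. -/
def Q (f : L2) : ℝ := 1 / 2 * ∫ x in Ioo 0 Real.pi, Real.sin x * f x

/-- The Kaplan time. -/
def kaplanTime (p : ℕ) (f₀ : H10) : ℝ :=
  -(1 / ((p : ℝ) - 1)) * Real.log (1 - 1 / Q (fn f₀) ^ (p - 1))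

end NLHeat

end

/-!
The proof is Kaplan's eigenfunction argument. Let `φ` solve the Volterra equation and put
`q t = Q (φ t)`, which is, up to a constant factor, the first Fourier coefficient of `φ t`.
Testing the equation against `sin` gives `(e^t q)' = e^t Q (φ ^ p)` (`IsSolution.exp_mul_Q`). As
`½ sin` is a probability density on `(0, π)` and `φ ≥ 0`, Jensen's inequality (`Q_pow_le`) yields
`q' ≥ -q + q ^ p`, and a solution of this differential inequality with `q 0 > 1` cannot reach the
Kaplan time (`blowup`). So no domain of a solution contains the Kaplan time
(`IsSolution.lt_kaplanTime`), which gives both assertions.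

For odd `p`, Jensen's inequality needs `φ ≥ 0` (`IsSolution.nonneg`). Here `φ ^ p ≥ -C φ⁻` with `C`
bounded on compact time intervals, so testing the equation at time `t` against `φ⁻(t)` gives
`‖φ⁻(t)‖ ≤ C ∫₀ᵗ ‖φ⁻(s)‖ ds` in `L²`, and Gronwall's inequality forces `φ⁻ = 0`. This uses that
the heat semigroup is contractive and positive in `L²` (`abs_heatForm_le`, `heatForm_nonneg`).

Positivity of the semigroup amounts to `∑ q ^ (k ^ 2) sin (k x) sin (k y) ≥ 0` on `[0, π]²`, where
`q = e^{-t}`; equivalently, the theta function `1 + 2 ∑ q ^ (k ^ 2) cos (k θ)` is a nondecreasing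
function of `cos θ`. The Jacobi triple product makes this evident, since each factor
`1 + 2 q ^ (2 j + 1) cos θ + q ^ (4 j + 2)` is nonnegative and has this property. The argument
uses the finite form of the product, whose Fourier coefficients follow from a functional equation
(`thetaPoly_comp`, `thetaPoly_coeff`), and passes to the limit after integration
(`heatKernel_partial_nonneg`).

The integral in the equation is a Bochner integral, so before it can be tested its integrand has
to be shown integrable (`intervalIntegrable_heat_powMap`).
-/

open MeasureTheory Set
open scoped ContDiff

namespace NLHeat

/-! ### The finite Jacobi triple product -/

open Polynomial in
/-- The polynomial `∏_{j < n} (1 + q^{2j+1} X) (X + q^{2j+1})`, a truncation of the Jacobi triple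
product, multiplied by `X ^ n` to clear the negative powers. -/
noncomputable def thetaPoly (q : ℝ) (n : ℕ) : ℝ[X] :=
  ∏ j ∈ Finset.range n, (1 + C (q ^ (2 * j + 1)) * X) * (X + C (q ^ (2 * j + 1)))

lemma thetaPoly_succ (q : ℝ) (n : ℕ) : thetaPoly q (n + 1) = thetaPoly q n *
    ((1 + .C (q ^ (2 * n + 1)) * .X) * (.X + .C (q ^ (2 * n + 1)))) :=
  Finset.prod_range_succ _ _

lemma natDegree_thetaPoly_le (q : ℝ) (n : ℕ) : (thetaPoly q n).natDegree ≤ 2 * n := by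
  induction n with
  | zero => simp [thetaPoly]
  | succ n ih =>
    rw [thetaPoly_succ]
    refine Polynomial.natDegree_mul_le_of_le ih ?_
    compute_degree

open Polynomial in
/-- The quasi-periodicity of the theta function, in truncated form. -/
lemma thetaPoly_comp (q : ℝ) (n : ℕ) :
    (thetaPoly q n).comp (C (q ^ 2) * X) * (C q * X + C (q ^ (2 * n))) =
      C (q ^ (2 * n)) * thetaPoly q n * (1 + C (q ^ (2 * n + 1)) * X) := by
  induction n with
  | zero => simp [thetaPoly]; ring
  | succ n ih =>
    rw [thetaPoly_succ]
    simp only [mul_comp, add_comp, one_comp, C_comp, X_comp]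
    simp only [C_pow] at ih ⊢
    linear_combination C q * (1 + C q ^ (2 * n + 1) * (C q ^ 2 * X)) *
      (C q * X + C q ^ (2 * (n + 1))) * ih

lemma thetaPoly_coeff_succ (q : ℝ) (n i : ℕ) :
    q ^ (2 * n) * (1 - q ^ (2 * (i + 1))) * (thetaPoly q n).coeff (i + 1) =
      q * (q ^ (2 * i) - q ^ (4 * n)) * (thetaPoly q n).coeff i := by
  have h := congrArg (fun r => Polynomial.coeff r (i + 1)) (thetaPoly_comp q n)
  simp only [mul_add, ← mul_assoc, mul_one, Polynomial.coeff_add, Polynomial.coeff_mul_X,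
    Polynomial.coeff_mul_C, Polynomial.coeff_C_mul, Polynomial.comp_C_mul_X_coeff] at h
  linear_combination -h

/-- The ratio of the Gaussian binomial coefficients `[2n, n + k]` and `[2n, n]` to the base `Q`.
The truncated subtraction makes it vanish for `k > n`. -/
noncomputable def gaussRatio (Q : ℝ) (n k : ℕ) : ℝ :=
  ∏ j ∈ Finset.range k, (1 - Q ^ (n - j)) / (1 - Q ^ (n + j + 1))

lemma gaussRatio_succ (Q : ℝ) (n k : ℕ) : gaussRatio Q n (k + 1) =
    gaussRatio Q n k * ((1 - Q ^ (n - k)) / (1 - Q ^ (n + k + 1))) :=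
  Finset.prod_range_succ _ _

lemma gaussRatio_nonneg {Q : ℝ} (h0 : 0 ≤ Q) (h1 : Q < 1) (n k : ℕ) : 0 ≤ gaussRatio Q n k :=
  Finset.prod_nonneg fun _ _ => div_nonneg (sub_nonneg.2 (pow_le_one₀ h0 h1.le))
    (sub_nonneg.2 (pow_le_one₀ h0 h1.le))

lemma gaussRatio_le_one {Q : ℝ} (h0 : 0 ≤ Q) (h1 : Q < 1) (n k : ℕ) : gaussRatio Q n k ≤ 1 := by
  refine Finset.prod_le_one (fun _ _ => div_nonneg (sub_nonneg.2 (pow_le_one₀ h0 h1.le))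
    (sub_nonneg.2 (pow_le_one₀ h0 h1.le))) fun j _ => ?_
  refine div_le_one_of_le₀ ?_ (sub_nonneg.2 (pow_le_one₀ h0 h1.le))
  gcongr ?_ - ?_
  exact pow_le_pow_of_le_one h0 h1.le (by omega)

lemma gaussRatio_eq_zero {Q : ℝ} {n k : ℕ} (h : n < k) : gaussRatio Q n k = 0 :=
  Finset.prod_eq_zero (Finset.mem_range.2 h) (by simp)

lemma tendsto_gaussRatio {Q : ℝ} (h0 : 0 ≤ Q) (h1 : Q < 1) (k : ℕ) :
    Filter.Tendsto (fun n => gaussRatio Q n k) Filter.atTop (nhds 1) := by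
  have h := tendsto_pow_atTop_nhds_zero_of_lt_one h0 h1
  have : ∀ j ∈ Finset.range k, Filter.Tendsto
      (fun n => (1 - Q ^ (n - j)) / (1 - Q ^ (n + j + 1))) Filter.atTop (nhds 1) := by
    intro j _
    have e1 := (h.comp (Filter.tendsto_sub_atTop_nat j)).const_sub 1
    have e2 := (h.comp (Filter.tendsto_add_atTop_nat (j + 1))).const_sub 1
    simpa [Pi.div_def, add_assoc] using e1.div e2 (by simp)
  simpa [gaussRatio] using tendsto_finsetProd _ this

/-- The coefficients of the truncated triple product, normalised by the middle one, are
`q ^ (k ^ 2)` up to factors that tend to `1`. Comparison of coefficients in `thetaPoly_comp` gives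
the ratio of neighbours. -/
lemma thetaPoly_coeff {q : ℝ} (h0 : 0 < q) (h1 : q < 1) {n k : ℕ} (hk : k ≤ n) :
    (thetaPoly q n).coeff (n + k) =
        (thetaPoly q n).coeff n * (gaussRatio (q ^ 2) n k * q ^ k ^ 2) ∧
      (thetaPoly q n).coeff (n - k) =
        (thetaPoly q n).coeff n * (gaussRatio (q ^ 2) n k * q ^ k ^ 2) := by
  have hpos : ∀ m : ℕ, m ≠ 0 → 0 < 1 - (q ^ 2) ^ m := fun m hm => by
    rw [sub_pos, ← pow_mul]; exact pow_lt_one₀ h0.le h1 (by omega)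
  induction k with
  | zero => simp [gaussRatio]
  | succ k ih =>
    obtain ⟨m, rfl⟩ : ∃ m, n = m + k + 1 := ⟨n - (k + 1), by omega⟩
    obtain ⟨ih1, ih2⟩ := ih (by omega)
    set b := (thetaPoly q (m + k + 1)).coeff with hb
    have e1 := thetaPoly_coeff_succ q (m + k + 1) (m + k + 1 + k)
    have e2 := thetaPoly_coeff_succ q (m + k + 1) m
    rw [← hb] at e1 e2
    rw [show m + k + 1 - k = m + 1 by omega] at ih2
    rw [show m + k + 1 - (k + 1) = m by omega, gaussRatio_succ,
      show m + k + 1 - k = m + 1 by omega, ← add_assoc]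
    rw [ih1] at e1
    rw [ih2] at e2
    have p1 := hpos (m + 1) (by omega)
    have p2 := hpos (m + k + 1 + k + 1) (by omega)
    simp only [← pow_mul] at p1 p2
    have hq := h0.ne'
    have p2' := p2.ne'
    constructor
    · have hz : q ^ (2 * (m + k + 1)) * (1 - q ^ (2 * (m + k + 1 + k + 1))) ≠ 0 := by positivity
      refine mul_left_cancel₀ hz (e1.trans ?_)
      simp only [← pow_mul]
      field_simp
      ring
    · have hz : q * q ^ (2 * m) * (1 - q ^ (2 * (m + k + 1 + k + 1))) ≠ 0 := by positivity
      refine mul_left_cancel₀ hz (Eq.trans ?_ (e2.symm.trans ?_))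
      · ring
      · simp only [← pow_mul]
        field_simp
        ring

/-- The truncated triple product at a point `e^{iθ}` of the unit circle, as a function of
`c = cos θ`. -/
noncomputable def thetaProd (q : ℝ) (n : ℕ) (c : ℝ) : ℝ :=
  ∏ j ∈ Finset.range n, (1 + 2 * q ^ (2 * j + 1) * c + (q ^ (2 * j + 1)) ^ 2)

lemma thetaProd_mono {q : ℝ} (h0 : 0 ≤ q) (n : ℕ) {c d : ℝ} (hc : -1 ≤ c) (hcd : c ≤ d) :
    thetaProd q n c ≤ thetaProd q n d := by
  refine Finset.prod_le_prod (fun j _ => ?_) (fun j _ => ?_)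
  · have : 0 ≤ q ^ (2 * j + 1) := by positivity
    nlinarith [sq_nonneg (1 - q ^ (2 * j + 1))]
  · gcongr

open Complex in
lemma thetaProd_cos (q : ℝ) (n : ℕ) (θ : ℝ) :
    thetaProd q n (Real.cos θ) =
      ∑ i ∈ Finset.range (2 * n + 1), (thetaPoly q n).coeff i * Real.cos (((i : ℝ) - n) * θ) := by
  have hz : exp (θ * I) ≠ 0 := exp_ne_zero _
  have h1 : (thetaProd q n (Real.cos θ) : ℂ) * exp (θ * I) ^ n =
      Polynomial.aeval (exp (θ * I)) (thetaPoly q n) := by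
    induction n with
    | zero => simp [thetaProd, thetaPoly]
    | succ n ih =>
      rw [thetaPoly_succ, map_mul, ← ih, thetaProd, thetaProd, Finset.prod_range_succ]
      have hc : 2 * (Real.cos θ : ℂ) * exp (θ * I) = exp (θ * I) ^ 2 + 1 := by
        rw [ofReal_cos, Complex.cos, neg_mul, exp_neg]
        field_simp
      simp only [map_mul, map_add, map_one, Polynomial.aeval_X, Polynomial.aeval_C,
        Complex.coe_algebraMap]
      push_cast at hc ⊢
      linear_combination (∏ j ∈ Finset.range n, (1 + 2 * (q : ℂ) ^ (2 * j + 1) * cos θ +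
        ((q : ℂ) ^ (2 * j + 1)) ^ 2)) * exp (θ * I) ^ n * q ^ (2 * n + 1) * hc
  rw [Polynomial.aeval_eq_sum_range' (Nat.lt_succ_of_le (natDegree_thetaPoly_le q n))] at h1
  have h2 : (thetaProd q n (Real.cos θ) : ℂ) =
      ∑ i ∈ Finset.range (2 * n + 1), ((thetaPoly q n).coeff i : ℂ) *
        exp ((((i : ℝ) - n) * θ : ℝ) * I) := by
    refine mul_right_cancel₀ (pow_ne_zero n hz) (h1.trans ?_)
    rw [Finset.sum_mul]
    refine Finset.sum_congr rfl fun i _ => ?_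
    rw [Complex.real_smul, mul_assoc, ← exp_nat_mul, ← exp_nat_mul, ← exp_add]
    congr 2
    push_cast
    ring
  have h3 := congrArg Complex.re h2
  simpa only [ofReal_re, re_sum, re_ofReal_mul, exp_ofReal_mul_I_re] using h3

/-- The partial sums of the Dirichlet heat kernel on `(0, π)`, damped by the factors `gaussRatio`,
are nonnegative. -/
lemma heatKernel_partial_nonneg {q : ℝ} (h0 : 0 < q) (h1 : q < 1) (n : ℕ) {x y : ℝ}
    (hx : x ∈ Icc 0 Real.pi) (hy : y ∈ Icc 0 Real.pi) :
    0 ≤ ∑ k ∈ Finset.range n, gaussRatio (q ^ 2) n (k + 1) * q ^ (k + 1) ^ 2 *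
      (Real.sin ((k + 1 : ℕ) * x) * Real.sin ((k + 1 : ℕ) * y)) := by
  set b := (thetaPoly q n).coeff with hb
  -- an even sequence, summed against the coefficients
  have hfold : ∀ u : ℝ → ℝ, (∀ s, u (-s) = u s) →
      ∑ i ∈ Finset.range (2 * n + 1), b i * u ((i : ℝ) - n) =
        b n * (u 0 + 2 * ∑ k ∈ Finset.range n,
          gaussRatio (q ^ 2) n (k + 1) * q ^ (k + 1) ^ 2 * u (k + 1 : ℕ)) := by
    intro u hu
    rw [show 2 * n + 1 = n + (n + 1) by ring, Finset.sum_range_add,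
      Finset.sum_range_succ' _ n, ← Finset.sum_range_reflect]
    have e1 : ∀ k ∈ Finset.range n, b (n - 1 - k) * u (((n - 1 - k : ℕ) : ℝ) - n) =
        b n * (gaussRatio (q ^ 2) n (k + 1) * q ^ (k + 1) ^ 2 * u (k + 1 : ℕ)) := by
      intro k hk
      have hk' : k + 1 ≤ n := Finset.mem_range.1 hk
      rw [show n - 1 - k = n - (k + 1) by omega, hb, (thetaPoly_coeff h0 h1 hk').2, ← hu,
        Nat.cast_sub hk']
      rw [show -((n : ℝ) - (k + 1 : ℕ) - n) = (k + 1 : ℕ) by ring]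
      ring
    have e2 : ∀ k ∈ Finset.range n, b (n + (k + 1)) * u (((n + (k + 1) : ℕ) : ℝ) - n) =
        b n * (gaussRatio (q ^ 2) n (k + 1) * q ^ (k + 1) ^ 2 * u (k + 1 : ℕ)) := by
      intro k hk
      have hk' : k + 1 ≤ n := Finset.mem_range.1 hk
      rw [hb, (thetaPoly_coeff h0 h1 hk').1, Nat.cast_add n (k + 1), add_sub_cancel_left]
      ring
    rw [Finset.sum_congr rfl e1, Finset.sum_congr rfl e2, ← Finset.mul_sum]
    simp only [add_zero, sub_self]
    ring
  -- all coefficients are nonnegative multiples of `b n`, and their sum, the value at `θ = 0`, is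
  -- positive
  have hbn : 0 < b n := by
    have e1 := hfold (fun _ => 1) (fun _ => rfl)
    have e2 : 0 < thetaProd q n (Real.cos 0) :=
      Finset.prod_pos fun j _ => by rw [Real.cos_zero]; positivity
    rw [thetaProd_cos] at e2
    simp only [mul_zero, Real.cos_zero, mul_one] at e1 e2
    rw [← hb, e1] at e2
    refine pos_of_mul_pos_left e2 ?_
    have := fun k => gaussRatio_nonneg (sq_nonneg q) (pow_lt_one₀ h0.le h1 two_ne_zero) n (k + 1)
    have : 0 ≤ ∑ k ∈ Finset.range n, gaussRatio (q ^ 2) n (k + 1) * q ^ (k + 1) ^ 2 :=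
      Finset.sum_nonneg fun k _ => mul_nonneg (this k) (by positivity)
    positivity
  have e1 := hfold (fun s => Real.cos (s * (x - y)) - Real.cos (s * (x + y)))
    (fun s => by simp only [neg_mul, Real.cos_neg])
  have e2 : thetaProd q n (Real.cos (x + y)) ≤ thetaProd q n (Real.cos (x - y)) := by
    refine thetaProd_mono h0.le n (Real.neg_one_le_cos _) ?_
    rw [Real.cos_add, Real.cos_sub]
    have := mul_nonneg (Real.sin_nonneg_of_mem_Icc hx) (Real.sin_nonneg_of_mem_Icc hy)
    linarith
  rw [← sub_nonneg, thetaProd_cos, thetaProd_cos, ← Finset.sum_sub_distrib] at e2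
  simp only [← mul_sub] at e2
  rw [← hb, e1, zero_mul, zero_mul, sub_self, zero_add] at e2
  have e3 := nonneg_of_mul_nonneg_right e2 hbn
  have e4 : ∑ k ∈ Finset.range n, gaussRatio (q ^ 2) n (k + 1) * q ^ (k + 1) ^ 2 *
      (Real.cos ((k + 1 : ℕ) * (x - y)) - Real.cos ((k + 1 : ℕ) * (x + y))) =
      2 * ∑ k ∈ Finset.range n, gaussRatio (q ^ 2) n (k + 1) * q ^ (k + 1) ^ 2 *
      (Real.sin ((k + 1 : ℕ) * x) * Real.sin ((k + 1 : ℕ) * y)) := by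
    rw [Finset.mul_sum]
    refine Finset.sum_congr rfl fun k _ => ?_
    rw [mul_sub ((k + 1 : ℕ) : ℝ), mul_add ((k + 1 : ℕ) : ℝ), Real.cos_sub, Real.cos_add]
    ring
  rw [e4] at e3
  linarith

/-! ### Diagonal operators -/

/-- A diagonal operator with entries of absolute value at most `1` in an orthonormal system has
norm at most `1`. -/
lemma diagonal_bound {E : Type*} [NormedAddCommGroup E] [InnerProductSpace ℝ E] {v : ℕ → E}
    (hv : Orthonormal ℝ v) {c : ℕ → ℝ} (hc : ∀ k, |c k| ≤ 1) (f g : E) :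
    Summable (fun k => |c k * (inner ℝ (v k) f * inner ℝ (v k) g)|) ∧
      |∑' k, c k * (inner ℝ (v k) f * inner ℝ (v k) g)| ≤ ‖f‖ * ‖g‖ := by
  have hb : ∀ (s : Finset ℕ) (f : E), √(∑ k ∈ s, |inner ℝ (v k) f| ^ 2) ≤ ‖f‖ := fun s f => by
    rw [Real.sqrt_le_left (norm_nonneg _)]
    exact hv.sum_inner_products_le f
  have hs : ∀ s : Finset ℕ,
      ∑ k ∈ s, |c k * (inner ℝ (v k) f * inner ℝ (v k) g)| ≤ ‖f‖ * ‖g‖ := fun s => by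
    calc ∑ k ∈ s, |c k * (inner ℝ (v k) f * inner ℝ (v k) g)|
        ≤ ∑ k ∈ s, |inner ℝ (v k) f| * |inner ℝ (v k) g| := by
          refine Finset.sum_le_sum fun k _ => ?_
          rw [abs_mul, abs_mul]
          exact mul_le_of_le_one_left (by positivity) (hc k)
      _ ≤ √(∑ k ∈ s, |inner ℝ (v k) f| ^ 2) * √(∑ k ∈ s, |inner ℝ (v k) g| ^ 2) :=
          Real.sum_mul_le_sqrt_mul_sqrt _ _ _
      _ ≤ ‖f‖ * ‖g‖ := mul_le_mul (hb s f) (hb s g) (Real.sqrt_nonneg _) (norm_nonneg _)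
  have hsum := summable_of_sum_le (fun k => abs_nonneg _) hs
  refine ⟨hsum, ?_⟩
  have h1 : ‖∑' k, c k * (inner ℝ (v k) f * inner ℝ (v k) g)‖ ≤
      ∑' k, ‖c k * (inner ℝ (v k) f * inner ℝ (v k) g)‖ := norm_tsum_le_tsum_norm hsum
  exact h1.trans (hsum.tsum_le_of_sum_le hs)

/-! ### Sines and the heat semigroup -/

lemma norm_sq_eq (f : H10) : ‖f‖ ^ 2 = ‖fn f‖ ^ 2 + ‖der f‖ ^ 2 := by
  simp only [← real_inner_self_eq_norm_sq]
  exact inner_H10 f f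

lemma norm_fn_le (f : H10) : ‖fn f‖ ≤ ‖f‖ :=
  le_of_sq_le_sq (by rw [norm_sq_eq]; nlinarith [sq_nonneg ‖der f‖]) (norm_nonneg _)

lemma norm_der_le (f : H10) : ‖der f‖ ≤ ‖f‖ :=
  le_of_sq_le_sq (by rw [norm_sq_eq]; nlinarith [sq_nonneg ‖fn f‖]) (norm_nonneg _)

/-- The embedding of `H¹₀(0, π)` into `L²(0, π)`. -/
noncomputable def fnL : H10 →L[ℝ] L2 :=
  LinearMap.mkContinuous { toFun := fn, map_add' := fun _ _ => rfl, map_smul' := fun _ _ => rfl } 1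
    fun f => by rw [one_mul]; exact norm_fn_le f

@[simp] lemma fnL_apply (f : H10) : fnL f = fn f := rfl

lemma orthonormal_fn_sine : Orthonormal ℝ fun k : ℕ => fn (sine (k + 1)) := by
  rw [orthonormal_iff_ite]
  intro i j
  split_ifs with h
  · rw [h, norm_fn_sine (by omega)]
  · have h1 := inner_sine (i + 1) (sine (j + 1))
    rw [inner_sine_sine (by omega)] at h1
    exact (mul_eq_zero.1 h1.symm).resolve_left (by positivity)

/-- The sines, normalised in `H¹₀(0, π)`. -/
lemma exists_orthonormal_sine : ∃ v : ℕ → H10, Orthonormal ℝ v ∧ ∀ k f,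
    (inner ℝ (v k) f : ℝ) • v k = (inner ℝ (fn (sine (k + 1))) (fn f) : ℝ) • sine (k + 1) := by
  let r : ℕ → ℝ := fun k => (√(1 + ((k + 1 : ℕ) : ℝ) ^ 2))⁻¹
  have hr : ∀ k, r k * r k * (1 + ((k + 1 : ℕ) : ℝ) ^ 2) = 1 := fun k => by
    have h0 : (0 : ℝ) < 1 + ((k + 1 : ℕ) : ℝ) ^ 2 := by positivity
    simp only [r]
    rw [← mul_inv, Real.mul_self_sqrt h0.le, inv_mul_cancel₀ h0.ne']
  refine ⟨fun k => r k • sine (k + 1), ?_, fun k f => ?_⟩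
  · rw [orthonormal_iff_ite]
    intro i j
    rw [real_inner_smul_left (sine (i + 1)) _ (r i), real_inner_smul_right _ (sine (j + 1)) (r j)]
    split_ifs with h
    · subst h
      rw [inner_sine, norm_fn_sine (by omega), mul_one, ← mul_assoc, hr]
    · rw [inner_sine_sine (by omega)]; simp
  · rw [real_inner_smul_left (sine (k + 1)) f (r k), inner_sine, smul_smul]
    congr 1
    linear_combination (inner ℝ (fn (sine (k + 1))) (fn f) : ℝ) * hr k

/-- The factor `exp (-k² t)`, with `k` shifted by one. -/
noncomputable def decay (t : ℝ) (k : ℕ) : ℝ := Real.exp (-((k + 1 : ℕ) : ℝ) ^ 2 * t)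

lemma abs_decay_le_one {t : ℝ} (ht : 0 ≤ t) (k : ℕ) : |decay t k| ≤ 1 := by
  rw [decay, Real.abs_exp, Real.exp_le_one_iff]
  have : 0 ≤ ((k + 1 : ℕ) : ℝ) ^ 2 * t := by positivity
  linarith

/-- The bilinear form `⟨g, U(t) h⟩` of the heat semigroup on `L²(0, π)`. -/
noncomputable def heatForm (t : ℝ) (g h : L2) : ℝ :=
  ∑' k : ℕ, decay t k * (inner ℝ (fn (sine (k + 1))) g * inner ℝ (fn (sine (k + 1))) h)

lemma heatForm_summable {t : ℝ} (ht : 0 ≤ t) (g h : L2) : Summable fun k : ℕ =>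
    decay t k * (inner ℝ (fn (sine (k + 1))) g * inner ℝ (fn (sine (k + 1))) h : ℝ) :=
  (diagonal_bound orthonormal_fn_sine (abs_decay_le_one ht) g h).1.of_abs

lemma abs_heatForm_le {t : ℝ} (ht : 0 ≤ t) (g h : L2) : |heatForm t g h| ≤ ‖g‖ * ‖h‖ :=
  (diagonal_bound orthonormal_fn_sine (abs_decay_le_one ht) g h).2

lemma heatForm_add {t : ℝ} (ht : 0 ≤ t) (g h₁ h₂ : L2) :
    heatForm t g (h₁ + h₂) = heatForm t g h₁ + heatForm t g h₂ := by
  rw [heatForm, heatForm, heatForm,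
    ← (heatForm_summable ht g h₁).tsum_add (heatForm_summable ht g h₂)]
  simp only [inner_add_right, mul_add]

lemma heatForm_smul (t : ℝ) (g h : L2) (c : ℝ) :
    heatForm t g (c • h) = c * heatForm t g h := by
  rw [heatForm, heatForm, ← tsum_mul_left]
  congr 1; ext k
  rw [real_inner_smul_right]; ring

lemma inner_fn_heat {t : ℝ} (ht : 0 ≤ t) (g : L2) (f : H10) :
    inner ℝ g (fn (heat t f)) = heatForm t g (fn f) := by
  have h := (((innerSL ℝ g).comp fnL).hasSum (heat_summable ht f).hasSum).tsum_eq
  change _ = inner ℝ g (fn (heat t f)) at h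
  rw [← h, heatForm]
  congr 1; ext k
  simp only [ContinuousLinearMap.comp_apply, map_smul, innerSL_apply_apply, smul_eq_mul, fnL_apply]
  rw [real_inner_comm g, decay]; ring

lemma heatForm_sine_one (t : ℝ) (h : L2) :
    heatForm t (fn (sine 1)) h = Real.exp (-t) * inner ℝ (fn (sine 1)) h := by
  have ho := orthonormal_iff_ite.1 orthonormal_fn_sine
  rw [heatForm, tsum_eq_single 0]
  · have := ho 0 0
    simp only [zero_add, if_true] at this
    rw [zero_add, this, one_mul]
    simp [decay]
  · intro k hk
    have := ho k 0
    simp only [zero_add, if_neg hk] at this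
    rw [this]; ring

/-- The heat semigroup is contractive in `H¹₀(0, π)`. -/
lemma norm_heat_le {t : ℝ} (ht : 0 ≤ t) (f : H10) : ‖heat t f‖ ≤ ‖f‖ := by
  obtain ⟨v, hv, hvs⟩ := exists_orthonormal_sine
  set w := heat t f with hw
  have h := ((innerSL ℝ w).hasSum (heat_summable ht f).hasSum).tsum_eq
  change _ = inner ℝ w w at h
  have h2 := (diagonal_bound hv (abs_decay_le_one ht) f w).2
  have h3 : ∀ k : ℕ, innerSL ℝ w ((Real.exp (-((k + 1 : ℕ) : ℝ) ^ 2 * t) *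
      (inner ℝ (fn (sine (k + 1))) (fn f) : ℝ)) • sine (k + 1)) =
      decay t k * (inner ℝ (v k) f * inner ℝ (v k) w) := by
    intro k
    rw [mul_smul, ← hvs, map_smul, map_smul, innerSL_apply_apply, real_inner_comm (v k) w]
    rfl
  simp only [h3] at h
  rw [h, real_inner_self_eq_norm_mul_norm, abs_of_nonneg (by positivity)] at h2
  by_contra! hlt
  have : 0 < ‖w‖ := (norm_nonneg f).trans_lt hlt
  nlinarith

/-! ### Positivity of the heat semigroup -/

lemma inner_fn_sine (k : ℕ) (g : L2) : inner ℝ (fn (sine k)) g =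
    √(2 / Real.pi) * ∫ x in Ioo 0 Real.pi, g x * Real.sin (k * x) := by
  rw [L2.inner_def, ← integral_const_mul]
  apply integral_congr_ae
  filter_upwards [coeFn_sine k] with x hx
  simp only [hx, RCLike.inner_apply, conj_trivial]
  ring

/-- A sum of products of sines that is pointwise nonnegative defines a nonnegative form. -/
lemma sineForm_nonneg {n : ℕ} {c : ℕ → ℝ}
    (hc : ∀ x ∈ Icc 0 Real.pi, ∀ y ∈ Icc 0 Real.pi, 0 ≤ ∑ k ∈ Finset.range n,
      c k * (Real.sin ((k + 1 : ℕ) * x) * Real.sin ((k + 1 : ℕ) * y)))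
    {g h : L2} (hg : ∀ᵐ x ∂leb, 0 ≤ g x) (hh : ∀ᵐ x ∂leb, 0 ≤ h x) :
    0 ≤ ∑ k ∈ Finset.range n, c k *
      (inner ℝ (fn (sine (k + 1))) g * inner ℝ (fn (sine (k + 1))) h) := by
  have hin : ∀ x : ℝ, ∫ y in Ioo 0 Real.pi, h y * ∑ k ∈ Finset.range n,
      c k * (Real.sin ((k + 1 : ℕ) * x) * Real.sin ((k + 1 : ℕ) * y)) =
      ∑ k ∈ Finset.range n, c k * (∫ y in Ioo 0 Real.pi, h y * Real.sin ((k + 1 : ℕ) * y)) *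
        Real.sin ((k + 1 : ℕ) * x) := by
    intro x
    simp only [Finset.mul_sum]
    rw [integral_finsetSum]
    · refine Finset.sum_congr rfl fun k _ => ?_
      rw [mul_assoc, mul_comm (∫ y in _, _), ← mul_assoc, ← integral_const_mul]
      congr 1; ext y; ring
    · exact fun k _ => integrable_L2_mul h (by fun_prop)
  have hout : ∫ x in Ioo 0 Real.pi, g x * (∫ y in Ioo 0 Real.pi, h y * ∑ k ∈ Finset.range n,
      c k * (Real.sin ((k + 1 : ℕ) * x) * Real.sin ((k + 1 : ℕ) * y))) =
      ∑ k ∈ Finset.range n, c k * ((∫ x in Ioo 0 Real.pi, g x * Real.sin ((k + 1 : ℕ) * x)) *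
        (∫ y in Ioo 0 Real.pi, h y * Real.sin ((k + 1 : ℕ) * y))) := by
    simp only [hin]
    simp only [Finset.mul_sum]
    rw [integral_finsetSum]
    · refine Finset.sum_congr rfl fun k _ => ?_
      generalize ∫ y in Ioo 0 Real.pi, h y * Real.sin ((k + 1 : ℕ) * y) = I
      rw [mul_comm (∫ x in _, _), ← mul_assoc, ← integral_const_mul]
      congr 1; ext x; ring
    · exact fun k _ => integrable_L2_mul g (by fun_prop)
  have hpos : 0 ≤ ∫ x in Ioo 0 Real.pi, g x * (∫ y in Ioo 0 Real.pi, h y *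
      ∑ k ∈ Finset.range n,
        c k * (Real.sin ((k + 1 : ℕ) * x) * Real.sin ((k + 1 : ℕ) * y))) := by
    refine integral_nonneg_of_ae ?_
    filter_upwards [hg, ae_restrict_mem measurableSet_Ioo] with x hx hx'
    refine mul_nonneg hx (integral_nonneg_of_ae ?_)
    filter_upwards [hh, ae_restrict_mem measurableSet_Ioo] with y hy hy'
    exact mul_nonneg hy (hc x (Ioo_subset_Icc_self hx') y (Ioo_subset_Icc_self hy'))
  rw [hout] at hpos
  have he : ∑ k ∈ Finset.range n, c k *
      (inner ℝ (fn (sine (k + 1))) g * inner ℝ (fn (sine (k + 1))) h) =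
      √(2 / Real.pi) ^ 2 * ∑ k ∈ Finset.range n, c k *
        ((∫ x in Ioo 0 Real.pi, g x * Real.sin ((k + 1 : ℕ) * x)) *
        (∫ y in Ioo 0 Real.pi, h y * Real.sin ((k + 1 : ℕ) * y))) := by
    rw [Finset.mul_sum]
    refine Finset.sum_congr rfl fun k _ => ?_
    rw [inner_fn_sine, inner_fn_sine]; ring
  rw [he]
  exact mul_nonneg (sq_nonneg _) hpos

/-- The heat semigroup preserves positivity. The partial sums of its kernel need not be nonnegative;
damped by `gaussRatio` they are, and the damping disappears in the limit. -/
lemma heatForm_nonneg {t : ℝ} (ht : 0 < t) {g h : L2} (hg : ∀ᵐ x ∂leb, 0 ≤ g x)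
    (hh : ∀ᵐ x ∂leb, 0 ≤ h x) : 0 ≤ heatForm t g h := by
  set q := Real.exp (-t) with hq
  have h0 : 0 < q := Real.exp_pos _
  have h1 : q < 1 := by rw [hq, Real.exp_lt_one_iff]; linarith
  have hQ0 : 0 ≤ q ^ 2 := sq_nonneg q
  have hQ1 : q ^ 2 < 1 := pow_lt_one₀ h0.le h1 two_ne_zero
  have hqk : ∀ k : ℕ, q ^ (k + 1) ^ 2 = decay t k := fun k => by
    rw [hq, ← Real.exp_nat_mul, decay]
    congr 1; push_cast; ring
  let a : ℕ → ℝ := fun k => inner ℝ (fn (sine (k + 1))) g * inner ℝ (fn (sine (k + 1))) h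
  have hlim : Filter.Tendsto
      (fun n => ∑' k, gaussRatio (q ^ 2) n (k + 1) * decay t k * a k) Filter.atTop
      (nhds (heatForm t g h)) := by
    refine tendsto_tsum_of_dominated_convergence
      (diagonal_bound orthonormal_fn_sine (abs_decay_le_one ht.le) g h).1 (fun k => ?_)
      (Filter.Eventually.of_forall fun n k => ?_)
    · have := ((tendsto_gaussRatio hQ0 hQ1 (k + 1)).mul_const (decay t k)).mul_const (a k)
      simpa using this
    · rw [mul_assoc, norm_mul, Real.norm_of_nonneg (gaussRatio_nonneg hQ0 hQ1 _ _)]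
      exact mul_le_of_le_one_left (norm_nonneg _) (gaussRatio_le_one hQ0 hQ1 _ _)
  refine ge_of_tendsto' hlim fun n => ?_
  rw [tsum_eq_sum (s := Finset.range n)]
  · refine sineForm_nonneg (c := fun k => gaussRatio (q ^ 2) n (k + 1) * decay t k)
      (fun x hx y hy => ?_) hg hh
    simp only [← hqk]
    exact heatKernel_partial_nonneg h0 h1 n hx hy
  · intro k hk
    rw [gaussRatio_eq_zero (by simpa [Nat.lt_succ_iff] using hk), zero_mul, zero_mul]

/-! ### The nonlinearity -/

/-- The embedding of `H¹₀(0, π)` into `L^∞(0, π)`. -/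
lemma exists_sup_bound : ∃ C : ℝ, 0 ≤ C ∧ ∀ f : H10, ∀ᵐ x ∂leb, |fn f x| ≤ C * ‖f‖ := by
  refine ⟨‖(memLp_of_continuousOn (u := fun _ => (1 : ℝ)) continuousOn_const).toLp _‖,
    norm_nonneg _, fun f => ?_⟩
  have h1 : ∫ x in Ioo 0 Real.pi, |der f x| ≤
      ‖(memLp_of_continuousOn (u := fun _ => (1 : ℝ)) continuousOn_const).toLp _‖ * ‖f‖ := by
    have e := integral_mul_eq_inner |der f| (θ := fun _ => 1) continuous_const
    have e' : ∫ x in Ioo 0 Real.pi, |der f x| =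
        ∫ x in Ioo 0 Real.pi, (|der f| : L2) x * 1 := by
      apply integral_congr_ae
      filter_upwards [Lp.coeFn_abs (der f)] with x hx
      rw [hx, mul_one]
    rw [e', e]
    refine (real_inner_le_norm _ _).trans ?_
    rw [norm_abs_eq_norm]
    exact mul_le_mul_of_nonneg_left (norm_der_le f) (norm_nonneg _)
  filter_upwards [(primitive_of_zeroTrace f.2.1 f.2.2).1, ae_restrict_mem measurableSet_Ioo]
    with x hx hx'
  change fn f x = primitive (der f) x at hx
  rw [hx]
  refine le_trans ?_ h1
  rw [primitive, intervalIntegral.integral_of_le hx'.1.le]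
  refine (abs_integral_le_integral_abs (f := der f)).trans ?_
  rw [integral_Ioc_eq_integral_Ioo]
  refine setIntegral_mono_set ?_ (Filter.Eventually.of_forall fun x => abs_nonneg _)
    (LE.le.eventuallyLE (Ioo_subset_Ioo_right hx'.2.le))
  exact ((Lp.memLp (der f)).integrable (by norm_num)).norm

variable {p : ℕ} (hp : 2 ≤ p)

lemma coeFn_powMap (f : H10) : fn (powMap hp f) =ᵐ[leb] fun x => fn f x ^ p :=
  (pow_facts p f).1.coeFn_toLp

lemma coeFn_der_powMap (f : H10) :
    der (powMap hp f) =ᵐ[leb] fun x => p * fn f x ^ (p - 1) * der f x :=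
  (pow_facts p f).2.1.coeFn_toLp

lemma norm_powMap_le {f : H10} {M : ℝ} (hM : 0 ≤ M) (hf : ∀ᵐ x ∂leb, |fn f x| ≤ M) :
    ‖powMap hp f‖ ≤ p * M ^ (p - 1) * ‖f‖ := by
  have hp1 : (1 : ℝ) ≤ p := by exact_mod_cast (by omega : 1 ≤ p)
  have h1 : ‖fn (powMap hp f)‖ ≤ p * M ^ (p - 1) * ‖fn f‖ := by
    refine Lp.norm_le_mul_norm_of_ae_le_mul ?_
    filter_upwards [coeFn_powMap hp f, hf] with x hx hx'
    rw [hx, norm_pow, Real.norm_eq_abs, ← Nat.sub_add_cancel (show 1 ≤ p by omega), pow_succ,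
      Nat.sub_add_cancel (show 1 ≤ p by omega)]
    refine mul_le_mul_of_nonneg_right ?_ (abs_nonneg _)
    have := pow_le_pow_left₀ (abs_nonneg _) hx' (p - 1)
    have h0 : 0 ≤ M ^ (p - 1) := pow_nonneg hM _
    nlinarith
  have h2 : ‖der (powMap hp f)‖ ≤ p * M ^ (p - 1) * ‖der f‖ := by
    refine Lp.norm_le_mul_norm_of_ae_le_mul ?_
    filter_upwards [coeFn_der_powMap hp f, hf] with x hx hx'
    rw [hx, norm_mul, norm_mul, norm_pow, Real.norm_natCast]
    gcongr
    exact hx'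
  refine le_of_sq_le_sq ?_ (by positivity)
  rw [mul_pow, norm_sq_eq, norm_sq_eq, mul_add, ← mul_pow, ← mul_pow]
  gcongr

lemma continuous_fn_powMap : Continuous fun f : H10 => fn (powMap hp f) := by
  obtain ⟨C, hC, hCf⟩ := exists_sup_bound
  rw [continuous_iff_continuousAt]
  intro f
  refine continuousAt_of_locally_lipschitz one_pos (p * (C * (‖f‖ + 1)) ^ (p - 1)) fun g hg => ?_
  have hgn : ‖g‖ ≤ ‖f‖ + 1 := by
    have := norm_le_norm_add_norm_sub' g f
    rw [← dist_eq_norm] at this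
    linarith
  rw [dist_eq_norm, dist_eq_norm]
  refine le_trans ?_ (mul_le_mul_of_nonneg_left (norm_fn_le (g - f)) (by positivity))
  refine Lp.norm_le_mul_norm_of_ae_le_mul ?_
  filter_upwards [coeFn_powMap hp f, coeFn_powMap hp g, hCf f, hCf g,
    Lp.coeFn_sub (fn (powMap hp g)) (fn (powMap hp f)), Lp.coeFn_sub (fn g) (fn f)]
    with x h1 h2 h3 h4 h5 h6
  change (fn (g - f)) x = _ at h6
  rw [h5, h6, Pi.sub_apply, Pi.sub_apply, h1, h2]
  refine (abs_pow_sub_pow_le _ _ _).trans ?_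
  rw [mul_assoc, mul_comm]
  refine mul_le_mul_of_nonneg_right ?_ (abs_nonneg _)
  gcongr
  refine max_le (h4.trans ?_) (h3.trans ?_) <;> gcongr
  linarith

/-! ### The Volterra equation, tested against functions in `L²` -/

/-- The integrand of the Volterra equation is measurable, as a limit of continuous partial sums, and
bounded, because the semigroup is contractive. -/
lemma intervalIntegrable_heat_powMap {φ : ℝ → H10} {t : ℝ} (ht : 0 ≤ t)
    (hφ : ContinuousOn φ (Icc 0 t)) :
    IntervalIntegrable (fun s => heat (t - s) (powMap hp (φ s))) volume 0 t := by
  obtain ⟨C, hC, hCf⟩ := exists_sup_bound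
  obtain ⟨R, hR⟩ := isCompact_Icc.exists_bound_of_continuousOn hφ
  have hR0 : 0 ≤ R := (norm_nonneg _).trans (hR 0 (left_mem_Icc.2 ht))
  rw [intervalIntegrable_iff_integrableOn_Icc_of_le ht]
  have hcont : ContinuousOn (fun s => fn (powMap hp (φ s))) (Icc 0 t) :=
    (continuous_fn_powMap hp).comp_continuousOn hφ
  refine Integrable.of_bound (C := p * (C * R) ^ (p - 1) * R) ?_ ?_
  · refine aestronglyMeasurable_of_tendsto_ae Filter.atTop
      (f := fun (n : ℕ) s => ∑ k ∈ Finset.range n, (Real.exp (-((k + 1 : ℕ) : ℝ) ^ 2 * (t - s)) *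
        (inner ℝ (fn (sine (k + 1))) (fn (powMap hp (φ s))) : ℝ)) • sine (k + 1))
      (fun n => ?_) ?_
    · refine ContinuousOn.aestronglyMeasurable ?_ measurableSet_Icc
      refine continuousOn_finsetSum _ fun k _ => ContinuousOn.fun_smul (ContinuousOn.fun_mul ?_ ?_)
        continuousOn_const
      · fun_prop
      · exact continuousOn_const.inner hcont
    · filter_upwards [ae_restrict_mem measurableSet_Icc] with s hs
      exact (heat_summable (sub_nonneg.2 hs.2) _).hasSum.tendsto_sum_nat
  · filter_upwards [ae_restrict_mem measurableSet_Icc] with s hs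
    refine (norm_heat_le (sub_nonneg.2 hs.2) _).trans ?_
    refine (norm_powMap_le hp (M := C * ‖φ s‖) (by positivity) (hCf _)).trans ?_
    have := hR s hs
    gcongr

variable {hp}

lemma IsSolution.inner_eq {f₀ : H10} {J : Set ℝ} {φ : ℝ → H10} (h : IsSolution hp f₀ J φ)
    {t : ℝ} (ht : 0 ≤ t) (htJ : Icc 0 t ⊆ J) (g : L2) :
    IntervalIntegrable (fun s => heatForm (t - s) g (fn (powMap hp (φ s)))) volume 0 t ∧
    inner ℝ g (fn (φ t)) = heatForm t g (fn f₀) +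
      ∫ s in (0)..t, heatForm (t - s) g (fn (powMap hp (φ s))) := by
  have hi := intervalIntegrable_heat_powMap hp ht (h.continuousOn.mono htJ)
  let ℓ : H10 →L[ℝ] ℝ := (innerSL ℝ g).comp fnL
  have hℓ : ∀ f, ℓ f = inner ℝ g (fn f) := fun f => rfl
  have he : ∀ s ∈ uIcc 0 t, ℓ (heat (t - s) (powMap hp (φ s))) =
      heatForm (t - s) g (fn (powMap hp (φ s))) := fun s hs => by
    rw [uIcc_of_le ht] at hs
    exact inner_fn_heat (sub_nonneg.2 hs.2) _ _
  constructor
  · have : IntervalIntegrable (fun s => ℓ (heat (t - s) (powMap hp (φ s)))) volume 0 t :=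
      ⟨ℓ.integrable_comp hi.1, ℓ.integrable_comp hi.2⟩
    exact this.congr fun s hs => he s (uIoc_subset_uIcc hs)
  · rw [← hℓ, h.volterra t (htJ (right_mem_Icc.2 ht)), map_add,
      ← ContinuousLinearMap.intervalIntegral_comp_comm ℓ hi,
      intervalIntegral.integral_congr he, hℓ, inner_fn_heat ht]

/-! ### Positivity of the solution -/

lemma hasDerivAt_integral {n : ℝ → ℝ} {T : ℝ} (hn : ContinuousOn n (Icc 0 T)) {x : ℝ}
    (hx : x ∈ Ioo 0 T) : HasDerivAt (fun t => ∫ s in (0)..t, n s) (n x) x := by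
  refine intervalIntegral.integral_hasDerivAt_right
    ((hn.mono ?_).intervalIntegrable)
    ((hn.mono Ioo_subset_Icc_self).stronglyMeasurableAtFilter isOpen_Ioo x hx)
    (hn.continuousAt (Icc_mem_nhds hx.1 hx.2))
  rw [uIcc_of_le hx.1.le]
  exact Icc_subset_Icc_right hx.2.le

lemma continuousOn_integral {n : ℝ → ℝ} {T : ℝ} (hT : 0 ≤ T) (hn : ContinuousOn n (Icc 0 T)) :
    ContinuousOn (fun t => ∫ s in (0)..t, n s) (Icc 0 T) := by
  rw [← uIcc_of_le hT] at hn ⊢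
  exact intervalIntegral.continuousOn_primitive_interval (hn.integrableOn_compact isCompact_uIcc)

/-- Gronwall's inequality in integral form, without inhomogeneous term. -/
lemma nonpos_of_le_integral {n : ℝ → ℝ} {T C : ℝ} (hC : 0 ≤ C) (hn : ContinuousOn n (Icc 0 T))
    (h : ∀ t ∈ Ioc 0 T, n t ≤ C * ∫ s in (0)..t, n s) {t : ℝ} (ht : t ∈ Ioc 0 T) : n t ≤ 0 := by
  have hT : 0 ≤ T := ht.1.le.trans ht.2
  have hd : ∀ x ∈ Ioo 0 T, HasDerivAt (fun t => Real.exp (-(C * t)) * ∫ s in (0)..t, n s)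
      (Real.exp (-(C * x)) * (-(C * 1)) * (∫ s in (0)..x, n s) + Real.exp (-(C * x)) * n x) x :=
    fun x hx => (((hasDerivAt_id x).const_mul C).neg.exp).mul (hasDerivAt_integral hn hx)
  have hanti : AntitoneOn (fun t => Real.exp (-(C * t)) * ∫ s in (0)..t, n s) (Icc 0 T) := by
    refine antitoneOn_of_deriv_nonpos (convex_Icc 0 T)
      (ContinuousOn.mul (by fun_prop) (continuousOn_integral hT hn)) ?_ ?_
    · rw [interior_Icc]
      exact fun x hx => (hd x hx).differentiableAt.differentiableWithinAt
    · rw [interior_Icc]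
      intro x hx
      rw [(hd x hx).deriv]
      have := mul_le_mul_of_nonneg_left (h x (Ioo_subset_Ioc_self hx))
        (Real.exp_pos (-(C * x))).le
      linarith
  have h1 := hanti (left_mem_Icc.2 hT) (Ioc_subset_Icc_self ht) ht.1.le
  simp only [intervalIntegral.integral_same, mul_zero] at h1
  have h2 := nonpos_of_mul_nonpos_right h1 (Real.exp_pos _)
  exact (h t ht).trans (mul_nonpos_of_nonneg_of_nonpos hC h2)

lemma inner_negPart (f : L2) : inner ℝ (Lp.negPart f) f = -‖Lp.negPart f‖ ^ 2 := by
  rw [← real_inner_self_eq_norm_sq, L2.inner_def, L2.inner_def, ← integral_neg]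
  apply integral_congr_ae
  filter_upwards [Lp.coeFn_negPart_eq_max f] with x hx
  simp only [hx, RCLike.inner_apply, conj_trivial]
  rcases le_total (f x) 0 with h | h
  · rw [max_eq_left (by linarith)]; ring
  · rw [max_eq_right (by linarith)]; ring

lemma negPart_nonneg (f : L2) : ∀ᵐ x ∂leb, 0 ≤ Lp.negPart f x := by
  filter_upwards [Lp.coeFn_negPart_eq_max f] with x hx
  rw [hx]; exact le_max_right _ _

/-- The solution stays nonnegative. Since `φ ^ p ≥ -C φ⁻`, the negative part `φ⁻` satisfies
`‖φ⁻(t)‖ ≤ C ∫₀ᵗ ‖φ⁻(s)‖ ds`. -/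
lemma IsSolution.nonneg {f₀ : H10} {J : Set ℝ} {φ : ℝ → H10} (h : IsSolution hp f₀ J φ)
    (hf₀ : ∀ᵐ x ∂leb, 0 ≤ fn f₀ x) {T : ℝ} (hTJ : Icc 0 T ⊆ J) {t : ℝ} (ht : t ∈ Ioc 0 T) :
    ∀ᵐ x ∂leb, 0 ≤ fn (φ t) x := by
  obtain ⟨C, hC, hCf⟩ := exists_sup_bound
  have hφ := h.continuousOn.mono hTJ
  obtain ⟨R, hR⟩ := isCompact_Icc.exists_bound_of_continuousOn hφ
  have hR0 : 0 ≤ R := (norm_nonneg _).trans (hR t (Ioc_subset_Icc_self ht))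
  set K := (C * R) ^ (p - 1) with hK
  have hK0 : 0 ≤ K := by positivity
  let u : ℝ → L2 := fun s => Lp.negPart (fn (φ s))
  have hu : ContinuousOn (fun s => ‖u s‖) (Icc 0 T) :=
    ((Lp.continuous_negPart.comp fnL.continuous).comp_continuousOn hφ).norm
  have hpow : ∀ s ∈ Icc 0 T, ∀ᵐ x ∂leb, 0 ≤ (fn (powMap hp (φ s)) + K • u s : L2) x := by
    intro s hs
    filter_upwards [coeFn_powMap hp (φ s), Lp.coeFn_add (fn (powMap hp (φ s))) (K • u s),
      Lp.coeFn_smul K (u s), Lp.coeFn_negPart_eq_max (fn (φ s)), hCf (φ s)] with x h1 h2 h3 h4 h5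
    rw [h2, Pi.add_apply, h1, h3, Pi.smul_apply, h4, smul_eq_mul]
    set a := fn (φ s) x
    rcases le_total 0 a with ha | ha
    · rw [max_eq_right (by linarith)]; positivity
    · rw [max_eq_left (by linarith)]
      have e1 : |a| ^ (p - 1) ≤ K := pow_le_pow_left₀ (abs_nonneg a)
        (h5.trans (mul_le_mul_of_nonneg_left (hR s hs) hC)) _
      have e2 : -|a| ^ p ≤ a ^ p := by rw [← abs_pow]; exact neg_abs_le _
      have e3 : |a| ^ p = |a| ^ (p - 1) * -a := by
        rw [← abs_of_nonpos ha, ← pow_succ, Nat.sub_add_cancel (show 1 ≤ p by omega)]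
      have := mul_le_mul_of_nonneg_right e1 (neg_nonneg.2 ha)
      linarith
  have key : ∀ t ∈ Ioc 0 T, ‖u t‖ ≤ K * ∫ s in (0)..t, ‖u s‖ := by
    intro t ht
    have htT : Icc 0 t ⊆ Icc 0 T := Icc_subset_Icc_right ht.2
    obtain ⟨hi, he⟩ := h.inner_eq ht.1.le (htT.trans hTJ) (u t)
    have hui : IntervalIntegrable (fun s => ‖u s‖) volume 0 t :=
      (hu.mono (by rwa [uIcc_of_le ht.1.le])).intervalIntegrable
    have hmono : ∫ s in (0)..t, -(K * ‖u t‖) * ‖u s‖ ≤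
        ∫ s in (0)..t, heatForm (t - s) (u t) (fn (powMap hp (φ s))) := by
      refine intervalIntegral.integral_mono_on_of_le_Ioo ht.1.le (hui.const_mul _) hi
        fun s hs => ?_
      have hs0 : 0 < t - s := sub_pos.2 hs.2
      have e1 := heatForm_nonneg hs0 (negPart_nonneg (fn (φ t)))
        (hpow s (htT (Ioo_subset_Icc_self hs)))
      change 0 ≤ heatForm (t - s) (u t) _ at e1
      rw [heatForm_add hs0.le, heatForm_smul] at e1
      have e2 := (le_abs_self _).trans (abs_heatForm_le hs0.le (u t) (u s))
      have e3 := mul_le_mul_of_nonneg_left e2 hK0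
      linarith
    rw [intervalIntegral.integral_const_mul] at hmono
    have e1 : inner ℝ (u t) (fn (φ t)) = -‖u t‖ ^ 2 := inner_negPart _
    have e2 := heatForm_nonneg ht.1 (negPart_nonneg (fn (φ t))) hf₀
    change 0 ≤ heatForm t (u t) _ at e2
    have e3 : ‖u t‖ * ‖u t‖ ≤ ‖u t‖ * (K * ∫ s in (0)..t, ‖u s‖) := by linarith
    rcases (norm_nonneg (u t)).eq_or_lt with h0 | h0
    · rw [← h0]
      exact mul_nonneg hK0 (intervalIntegral.integral_nonneg ht.1.le fun s _ => norm_nonneg _)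
    · exact le_of_mul_le_mul_left e3 h0
  have h0 : u t = 0 := norm_le_zero_iff.1 (nonpos_of_le_integral hK0 hu key ht)
  filter_upwards [Lp.coeFn_negPart_eq_max (fn (φ t)), Lp.coeFn_zero ℝ 2 leb] with x h1 h2
  change u t x = _ at h1
  rw [h0, h2, Pi.zero_apply] at h1
  have := le_max_left (-fn (φ t) x) 0
  linarith

/-! ### The Kaplan functional -/

lemma inner_sine_one (g : L2) : inner ℝ (fn (sine 1)) g = 2 * √(2 / Real.pi) * Q g := by
  rw [inner_fn_sine, Q]
  simp only [Nat.cast_one, one_mul, mul_comm (g _)]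
  ring

/-- The tangent to `y ^ p` at `m ≥ 0`. -/
lemma pow_tangent_le {p : ℕ} (hp : 2 ≤ p) {m y : ℝ} (hm : 0 ≤ m) (hy : 0 ≤ y) :
    m ^ p + p * m ^ (p - 1) * (y - m) ≤ y ^ p := by
  rcases hm.eq_or_lt with rfl | hm
  · rw [zero_pow (by omega), zero_pow (by omega)]
    simpa using pow_nonneg hy p
  · have h := one_add_mul_le_pow (a := y / m - 1) (by have := div_nonneg hy hm.le; linarith) p
    rw [add_sub_cancel, div_pow, le_div_iff₀ (pow_pos hm p)] at h
    refine le_trans (le_of_eq ?_) h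
    obtain ⟨n, rfl⟩ : ∃ n, p = n + 1 := ⟨p - 1, by omega⟩
    rw [Nat.add_sub_cancel, pow_succ]
    field_simp

lemma Q_nonneg {g : L2} (hg : ∀ᵐ x ∂leb, 0 ≤ g x) : 0 ≤ Q g := by
  refine mul_nonneg (by norm_num) (integral_nonneg_of_ae ?_)
  filter_upwards [hg, ae_restrict_mem measurableSet_Ioo] with x hx hx'
  exact mul_nonneg (Real.sin_nonneg_of_mem_Icc (Ioo_subset_Icc_self hx')) hx

/-- Jensen's inequality for the probability density `½ sin x` on `(0, π)`. -/
lemma Q_pow_le {p : ℕ} (hp : 2 ≤ p) {f : H10} (hf : ∀ᵐ x ∂leb, 0 ≤ fn f x) :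
    Q (fn f) ^ p ≤ Q (fn (powMap hp f)) := by
  set m := Q (fn f) with hm
  have hm0 : 0 ≤ m := Q_nonneg hf
  have hint : ∀ g : L2, IntegrableOn (fun x => Real.sin x * g x) (Ioo 0 Real.pi) volume :=
    fun g => (integrable_L2_mul g Real.continuous_sin).congr
      (Filter.Eventually.of_forall fun x => mul_comm _ _)
  have hs : IntegrableOn Real.sin (Ioo 0 Real.pi) volume :=
    (Real.continuous_sin.integrableOn_Icc (a := 0) (b := Real.pi)).mono_set Ioo_subset_Icc_self
  have hs2 : ∫ x in Ioo 0 Real.pi, Real.sin x = 2 := by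
    rw [setIntegral_eq, integral_sin]; simp; norm_num
  have h1 : ∫ x in Ioo 0 Real.pi, (p * m ^ (p - 1) * (Real.sin x * fn f x) +
      (m ^ p - p * m ^ (p - 1) * m) * Real.sin x) ≤
      ∫ x in Ioo 0 Real.pi, Real.sin x * fn (powMap hp f) x := by
    refine integral_mono_ae (((hint _).const_mul _).add (hs.const_mul _)) (hint _) ?_
    filter_upwards [coeFn_powMap hp f, hf, ae_restrict_mem measurableSet_Ioo] with x h1 h2 h3
    rw [h1]
    have := mul_le_mul_of_nonneg_left (pow_tangent_le hp hm0 h2)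
      (Real.sin_nonneg_of_mem_Icc (Ioo_subset_Icc_self h3))
    linarith
  rw [integral_add ((hint _).const_mul _) (hs.const_mul _), integral_const_mul,
    integral_const_mul, hs2] at h1
  have h2 : ∫ x in Ioo 0 Real.pi, Real.sin x * fn f x = 2 * m := by rw [hm, Q]; ring
  rw [h2] at h1
  rw [Q]
  linarith

lemma continuous_Q : Continuous Q := by
  have h : Q = fun g => (2 * √(2 / Real.pi))⁻¹ * inner ℝ (fn (sine 1)) g := by
    funext g
    have : √(2 / Real.pi) ≠ 0 := by have := Real.pi_pos; positivity
    rw [inner_sine_one]; field_simp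
  rw [h]
  exact continuous_const.mul (continuous_const.inner continuous_id)

/-- The equation for the first Fourier coefficient. -/
lemma IsSolution.exp_mul_Q {p : ℕ} {hp : 2 ≤ p} {f₀ : H10} {J : Set ℝ} {φ : ℝ → H10}
    (h : IsSolution hp f₀ J φ) {t : ℝ} (ht : 0 ≤ t) (htJ : Icc 0 t ⊆ J) :
    Real.exp t * Q (fn (φ t)) =
      Q (fn f₀) + ∫ s in (0)..t, Real.exp s * Q (fn (powMap hp (φ s))) := by
  have e := (h.inner_eq ht htJ (fn (sine 1))).2
  simp only [heatForm_sine_one, inner_sine_one] at e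
  have hc : 2 * √(2 / Real.pi) ≠ 0 := by have := Real.pi_pos; positivity
  have e2 : ∀ s, Real.exp (-(t - s)) * (2 * √(2 / Real.pi) * Q (fn (powMap hp (φ s)))) =
      2 * √(2 / Real.pi) * Real.exp (-t) * (Real.exp s * Q (fn (powMap hp (φ s)))) := fun s => by
    rw [show -(t - s) = -t + s by ring, Real.exp_add]; ring
  simp only [e2] at e
  rw [intervalIntegral.integral_const_mul] at e
  refine mul_left_cancel₀ hc ?_
  have h1 : Real.exp t * Real.exp (-t) = 1 := by rw [← Real.exp_add]; simp
  linear_combination Real.exp t * e + 2 * √(2 / Real.pi) *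
    (Q (fn f₀) + ∫ s in (0)..t, Real.exp s * Q (fn (powMap hp (φ s)))) * h1

/-- For `q = e^{-t} w`, the hypothesis `hle` is `q' ≥ -q + q ^ (m + 1)`. It makes
`w ^ (-m) - e^{-m t}` nonincreasing, while `w ^ (-m)` stays positive; this bounds the length of
the time interval. -/
lemma blowup {m : ℕ} (hm : m ≠ 0) {T : ℝ} {w w' : ℝ → ℝ} (hT : 0 ≤ T)
    (hw : ContinuousOn w (Icc 0 T)) (hd : ∀ t ∈ Ioo 0 T, HasDerivAt w (w' t) t)
    (hw' : ∀ t ∈ Ioo 0 T, 0 ≤ w' t)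
    (hle : ∀ t ∈ Ioo 0 T, Real.exp t * (Real.exp (-t) * w t) ^ (m + 1) ≤ w' t) (h0 : 0 < w 0) :
    1 - 1 / w 0 ^ m < Real.exp (-(m * T)) := by
  have hmono : MonotoneOn w (Icc 0 T) := by
    refine monotoneOn_of_deriv_nonneg (convex_Icc 0 T) hw ?_ ?_ <;> rw [interior_Icc]
    · exact fun t ht => (hd t ht).differentiableAt.differentiableWithinAt
    · exact fun t ht => by rw [(hd t ht).deriv]; exact hw' t ht
  have hpos : ∀ t ∈ Icc 0 T, 0 < w t := fun t ht =>
    h0.trans_le (hmono (left_mem_Icc.2 hT) ht ht.1)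
  have hd2 : ∀ t ∈ Ioo 0 T, HasDerivAt (fun t => (w t ^ m)⁻¹ - Real.exp (-(m * t)))
      (-(m * w t ^ (m - 1) * w' t) / (w t ^ m) ^ 2 - Real.exp (-(m * t)) * (-(m * 1))) t :=
    fun t ht => (((hd t ht).fun_pow m).fun_inv
      (pow_ne_zero m (hpos t (Ioo_subset_Icc_self ht)).ne')).sub
      (((hasDerivAt_id t).const_mul (m : ℝ)).neg.exp)
  have hanti : AntitoneOn (fun t => (w t ^ m)⁻¹ - Real.exp (-(m * t))) (Icc 0 T) := by
    refine antitoneOn_of_deriv_nonpos (convex_Icc 0 T) (ContinuousOn.sub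
      ((hw.pow m).inv₀ fun t ht => pow_ne_zero m (hpos t ht).ne') (by fun_prop)) ?_ ?_ <;>
      rw [interior_Icc]
    · exact fun t ht => (hd2 t ht).differentiableAt.differentiableWithinAt
    · intro t ht
      rw [(hd2 t ht).deriv]
      have hp := hpos t (Ioo_subset_Icc_self ht)
      have e1 : Real.exp t * (Real.exp (-t) * w t) ^ (m + 1) =
          Real.exp (-(m * t)) * w t ^ (m + 1) := by
        rw [mul_pow, ← mul_assoc, ← Real.exp_nat_mul, ← Real.exp_add]
        congr 2; push_cast; ring
      have h1 := hle t ht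
      rw [e1] at h1
      have e2 : (m * w t ^ (m - 1) * w' t) / (w t ^ m) ^ 2 = m * (w' t / w t ^ (m + 1)) := by
        obtain ⟨n, rfl⟩ : ∃ n, m = n + 1 := ⟨m - 1, by omega⟩
        rw [Nat.add_sub_cancel]
        field_simp
        ring
      rw [neg_div, e2]
      rw [← le_div_iff₀ (by positivity)] at h1
      have := mul_le_mul_of_nonneg_left h1 (Nat.cast_nonneg (α := ℝ) m)
      linarith
  have h1 := hanti (left_mem_Icc.2 hT) (right_mem_Icc.2 hT) hT
  simp only [mul_zero, neg_zero, Real.exp_zero] at h1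
  have h2 : 0 < (w T ^ m)⁻¹ := inv_pos.2 (pow_pos (hpos T (right_mem_Icc.2 hT)) m)
  rw [one_div]
  linarith

/-- The Kaplan time is not in the domain of any solution. -/
lemma IsSolution.lt_kaplanTime {p : ℕ} {hp : 2 ≤ p} {f₀ : H10} {J : Set ℝ} {φ : ℝ → H10}
    (h : IsSolution hp f₀ J φ) (hf₀ : ∀ᵐ x ∂leb, 0 ≤ fn f₀ x) (hQ : 1 < Q (fn f₀)) {T : ℝ}
    (hT : 0 ≤ T) (hTJ : Icc 0 T ⊆ J) : T < kaplanTime p f₀ := by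
  let F : ℝ → ℝ := fun s => Real.exp s * Q (fn (powMap hp (φ s)))
  have hF : ContinuousOn F (Icc 0 T) := Real.continuous_exp.continuousOn.mul
    ((continuous_Q.comp (continuous_fn_powMap hp)).comp_continuousOn (h.continuousOn.mono hTJ))
  have hw : ∀ t ∈ Icc 0 T, Q (fn f₀) + ∫ s in (0)..t, F s = Real.exp t * Q (fn (φ t)) :=
    fun t ht => (h.exp_mul_Q ht.1 ((Icc_subset_Icc_right ht.2).trans hTJ)).symm
  have hJ : ∀ t ∈ Ioo 0 T, Q (fn (φ t)) ^ p ≤ Q (fn (powMap hp (φ t))) := fun t ht =>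
    Q_pow_le hp (h.nonneg hf₀ hTJ (Ioo_subset_Ioc_self ht))
  have hq : ∀ t ∈ Ioo 0 T, 0 ≤ Q (fn (φ t)) := fun t ht =>
    Q_nonneg (h.nonneg hf₀ hTJ (Ioo_subset_Ioc_self ht))
  have hb := blowup (m := p - 1) (w := fun t => Q (fn f₀) + ∫ s in (0)..t, F s) (w' := F)
    (by omega) hT (continuousOn_const.add (continuousOn_integral hT hF))
    (fun t ht => (hasDerivAt_integral hF ht).const_add _)
    (fun t ht => mul_nonneg (Real.exp_pos t).le ((pow_nonneg (hq t ht) p).trans (hJ t ht)))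
    (fun t ht => by
      have e : Real.exp (-t) * (Real.exp t * Q (fn (φ t))) = Q (fn (φ t)) := by
        rw [← mul_assoc, ← Real.exp_add]; simp
      simp only [hw t (Ioo_subset_Icc_self ht)]
      rw [e, Nat.sub_add_cancel (show 1 ≤ p by omega)]
      exact mul_le_mul_of_nonneg_left (hJ t ht) (Real.exp_pos t).le)
    (by simp only [intervalIntegral.integral_same, add_zero]; linarith)
  simp only [intervalIntegral.integral_same, add_zero] at hb
  have h1 : 1 < Q (fn f₀) ^ (p - 1) := one_lt_pow₀ hQ (by omega)
  have h2 : 0 < 1 - 1 / Q (fn f₀) ^ (p - 1) := by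
    rw [sub_pos, div_lt_one (by linarith)]; exact h1
  have h3 := Real.log_lt_log h2 hb
  have hc : ((p - 1 : ℕ) : ℝ) = (p : ℝ) - 1 := by push_cast [show 1 ≤ p by omega]; ring
  have hp1 : (0 : ℝ) < (p : ℝ) - 1 := by
    rw [← hc]; exact_mod_cast (by omega : 0 < p - 1)
  rw [Real.log_exp, hc] at h3
  have e : kaplanTime p f₀ = (-Real.log (1 - 1 / Q (fn f₀) ^ (p - 1))) / ((p : ℝ) - 1) := by
    rw [kaplanTime]; ring
  rw [e, lt_div_iff₀ hp1]
  linarith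

lemma IsSolution.le_kaplanTime {p : ℕ} {hp : 2 ≤ p} {f₀ : H10} {ϑ : EReal} {φ : ℝ → H10}
    (h : IsSolution hp f₀ (timeInterval ϑ) φ) (hf₀ : ∀ᵐ x ∂leb, 0 ≤ fn f₀ x)
    (hQ : 1 < Q (fn f₀)) : ϑ ≤ (kaplanTime p f₀ : EReal) := by
  have hmem : ∀ T : ℝ, T ∈ timeInterval ϑ → T < kaplanTime p f₀ := fun T hT =>
    h.lt_kaplanTime hf₀ hQ hT.1 fun s hs =>
      ⟨hs.1, (EReal.coe_le_coe_iff.2 hs.2).trans_lt hT.2⟩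
  have h0 : (0 : ℝ) ∈ timeInterval ϑ := by
    rcases h.interval with hJ | ⟨T, hT, hJ | hJ⟩ <;> rw [hJ]
    exacts [self_mem_Ici, ⟨le_rfl, hT⟩, ⟨le_rfl, hT.le⟩]
  by_contra! hlt
  exact (hmem _ ⟨(hmem 0 h0).le, hlt⟩).false

end NLHeat

theorem proposition7p1 {p : ℕ} (hp : 2 ≤ p) (f₀ : NLHeat.H10)
    (hf₀ : ∀ᵐ x ∂NLHeat.leb, 0 ≤ NLHeat.fn f₀ x) (hQ : 1 < NLHeat.Q (NLHeat.fn f₀)) :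
    (∀ (ϑ : EReal) (φ : ℝ → NLHeat.H10),
      NLHeat.IsMaximalSolution hp f₀ (NLHeat.timeInterval ϑ) φ →
        ϑ ≤ (NLHeat.kaplanTime p f₀ : EReal)) ∧
    NLHeat.existenceTime hp f₀ ≤ (NLHeat.kaplanTime p f₀ : EReal) := by
  refine ⟨fun ϑ φ h => h.1.le_kaplanTime hf₀ hQ, sSup_le ?_⟩
  rintro T ⟨-, φ, h⟩
  exact h.le_kaplanTime hf₀ hQ
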